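/- Let $c$ be a smooth function on a set $I$ of values of $u$, and consider the potential system $$v_x=u_t,\qquad v_t=c^2(u)\,u_x \tag{P}$$ of the nonlinear wave equation $u_{tt}=(c^2(u)u_x)_x$. Under the change of variables $X=x$, $T=u$, $U=t+v$, $V=v$, and after exclusion of $V$, (P) leads to the scalar equation for $U(X,T)$ $$U_{TT}+c^2(T)\left(c^2(T)U_{XX}-U_{XX}U_T^2-U_{TT}U_X^2-2U_{TX}+2U_{TX}U_TU_X\right)-2c(T)c'(T)\left(U_X-U_X^2U_T\right)=0,\quad T\in I. \tag{S}$$ Say that a point symmetry $\mathbf W=W^X\partial_X+W^T\partial_T+W^U\partial_U$ of (S) *yields a nonlocal symmetry* of (P) if the following two properties hold. (a) $\mathbf W$ yields a symmetry of (P): for every smooth solution $(u,v)$ of (P) with $u\in I$ on an open convex set $D\subset\mathbb R^2$ there is a smooth function $f$ on $D$ such that the vector field $$W^X(x,u,t+v)\,\partial_x+f\,\partial_t+W^T(x,u,t+v)\,\partial_u+\left(W^U(x,u,t+v)-f\right)\partial_v ,$$ which induces $\mathbf W$ on the variables $(X,T,U)$, is an infinitesimal symmetry along $(u,v)$; that is,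 its evolutionary form $$\left(W^T-W^Xu_x-f u_t,\;\; W^U-f-W^Xv_x-f v_t\right)$$ solves the linearization of (P) at $(u,v)$. (b) This symmetry is not local: there is no differential function $f[u,v]$ (a smooth function of $x,t,u,v$ and finitely many partial derivatives of $u,v$, defined on some open set of jets that contains a jet satisfying (P) and all its differential consequences) such that the generalized vector field displayed in (a) with this $f$ is a local symmetry of (P), i.e. such that its infinite prolongation annihilates the equations of (P) modulo (P) and its differential consequences. Then the following holds. 1. For $c(u)=u^{-2}$, $I=\{u\ne0\}$, the vector field $\mathbf W_6=U^2\partial_U+TU\,\partial_T-\dfrac{U}{T^3}\,\partial_X$ is a point symmetry of (S), and it yields a nonlocal symmetry of (P). 2. For $c(u)=u^{-2/3}$, $I=\{u>0\}$, the vector field $\mathbf W_7=\left(XT-3T^{2/3}\right)\partial_T+\left(XT^{-1/3}-\dfrac{X^2}{3}\right)\partial_X$ is a point symmetry of (S), and it yields a nonlocal symmetry of (P). -/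

import Mathlib

open scoped ContDiff

noncomputable section

namespace NonlocalSymm

/-! ### Jets, differential functions, total derivatives

Two independent variables `(x, t)` and `m` dependent variables `w α`. -/

/-- Points of the infinite jet space: `z = (x, t, w)`, where `w α i j` is the jet coordinate that
stands for `∂ₓ^i ∂ₜ^j (w α)`. In particular `w α 0 0` is the value of the dependent variable. -/
abbrev Jet (m : ℕ) : Type := ℝ × ℝ × (Fin m → ℕ → ℕ → ℝ)

/-- Finite jets: only the coordinates `w α i j` with `i ≤ n` and `j ≤ n` are kept. -/
abbrev FinJet (m n : ℕ) : Type := ℝ × ℝ × (Fin m → Fin (n + 1) → Fin (n + 1) → ℝ)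

/-- The projection of an infinite jet to a finite jet. -/
def truncate {m : ℕ} (n : ℕ) (z : Jet m) : FinJet m n :=
  (z.1, z.2.1, fun α i j => z.2.2 α (i : ℕ) (j : ℕ))

/-- `F` is, over the set `Ω` of finite jets, a (smooth) differential function: there it is a smooth
function of `x`, `t`, the dependent variables and finitely many of their partial derivatives. -/
def IsDifferentialFunctionOn {m n : ℕ} (Ω : Set (FinJet m n)) (F : Jet m → ℝ) : Prop :=
  ∃ G : FinJet m n → ℝ, ContDiffOn ℝ ∞ G Ω ∧
    ∀ z : Jet m, truncate n z ∈ Ω → F z = G (truncate n z)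

/-- The total derivative `D_x = ∂_x + ∑ w α (i+1) j ∂_{w α i j}`. -/
def totalX {m : ℕ} (F : Jet m → ℝ) (z : Jet m) : ℝ :=
  lineDeriv ℝ F z ((1, 0, fun α i j => z.2.2 α (i + 1) j) : Jet m)

/-- The total derivative `D_t = ∂_t + ∑ w α i (j+1) ∂_{w α i j}`. -/
def totalT {m : ℕ} (F : Jet m → ℝ) (z : Jet m) : ℝ :=
  lineDeriv ℝ F z ((0, 1, fun α i j => z.2.2 α i (j + 1)) : Jet m)

/-! ### Generalized vector fields and their prolongation -/

/-- A generalized vector field `ξ ∂_x + τ ∂_t + ∑ η α ∂_{w α}`, whose components are functions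
on the jet space. -/
structure VField (m : ℕ) where
  ξ : Jet m → ℝ
  τ : Jet m → ℝ
  η : Fin m → Jet m → ℝ

/-- The characteristic `η α - ξ ∂ₓ(w α) - τ ∂ₜ(w α)`, that is, the components of the
evolutionary form. -/
def VField.char {m : ℕ} (X : VField m) (α : Fin m) (z : Jet m) : ℝ :=
  X.η α z - X.ξ z * z.2.2 α 1 0 - X.τ z * z.2.2 α 0 1

/-- The infinite prolongation of `X`, applied to the function `F` on the jet space:
`ξ D_x F + τ D_t F + ∑ (D_x^i D_t^j Q α) ∂F/∂(w α i j)` with `Q` the characteristic of `X`. -/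
def VField.prolong {m : ℕ} (X : VField m) (F : Jet m → ℝ) (z : Jet m) : ℝ :=
  X.ξ z * totalX F z + X.τ z * totalT F z +
    lineDeriv ℝ F z ((0, 0, fun α i j => (totalX^[i] (totalT^[j] (X.char α))) z) : Jet m)

/-! ### PDE systems, solutions, local symmetries -/

/-- A system of `s` differential equations `eq k = 0` for `m` unknown functions, considered on
the region `dom` of the jet space, where its coefficients are defined and smooth. -/
structure PDESystem (m s : ℕ) where
  dom : Set (Jet m)
  eq : Fin s → Jet m → ℝ

/-- The jets that satisfy the equations of the system and all their differential consequences. -/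
def PDESystem.prolonged {m s : ℕ} (S : PDESystem m s) : Set (Jet m) :=
  {z | z ∈ S.dom ∧ ∀ (k : Fin s) (i j : ℕ), (totalX^[i] (totalT^[j] (S.eq k))) z = 0}

/-- `X` is a local symmetry of `S` over `Ω`: its infinite prolongation annihilates the equations
of `S`, modulo the equations and their differential consequences. -/
def PDESystem.IsLocalSymmetryOn {m s n : ℕ} (S : PDESystem m s) (Ω : Set (FinJet m n))
    (X : VField m) : Prop :=
  ∀ z ∈ S.prolonged, truncate n z ∈ Ω → ∀ k, X.prolong (S.eq k) z = 0

/-- The infinite jet at `p` of the functions `w α` of two real variables. -/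
def jetOf {m : ℕ} (w : Fin m → ℝ × ℝ → ℝ) (p : ℝ × ℝ) : Jet m :=
  (p.1, p.2, fun α i j =>
    ((fun (g : ℝ × ℝ → ℝ) q => fderiv ℝ g q (1, 0))^[i]
      ((fun (g : ℝ × ℝ → ℝ) q => fderiv ℝ g q (0, 1))^[j] (w α))) p)

/-- Smooth solutions of a system on a set `D` (to be used for open `D`). -/
def PDESystem.IsSolutionOn {m s : ℕ} (S : PDESystem m s) (D : Set (ℝ × ℝ))
    (w : Fin m → ℝ × ℝ → ℝ) : Prop :=
  (∀ α, ContDiffOn ℝ ∞ (w α) D) ∧ ∀ p ∈ D, jetOf w p ∈ S.dom ∧ ∀ k, S.eq k (jetOf w p) = 0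

/-- `δ` is an infinitesimal deformation of `w` through solutions on `D`, i.e. a solution of the
system linearized at `w`: the functions `w + ε δ` satisfy the system to first order in `ε`. -/
def PDESystem.IsInfinitesimalDeformation {m s : ℕ} (S : PDESystem m s) (D : Set (ℝ × ℝ))
    (w δ : Fin m → ℝ × ℝ → ℝ) : Prop :=
  (∀ α, ContDiffOn ℝ ∞ (δ α) D) ∧ ∀ p ∈ D, ∀ k,
    HasDerivAt (fun ε : ℝ => S.eq k (jetOf (fun α q => w α q + ε * δ α q) p)) 0 0

/-! ### Point symmetries of a scalar equation -/

/-- A vector field `cX ∂_X + cT ∂_T + cU ∂_U` on the space of the variables `(X, T, U)`. -/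
structure PointField where
  cX : ℝ → ℝ → ℝ → ℝ
  cT : ℝ → ℝ → ℝ → ℝ
  cU : ℝ → ℝ → ℝ → ℝ

/-- A point field, as a vector field whose components depend on `(X, T, U)` only. -/
def PointField.toVField (W : PointField) : VField 1 where
  ξ z := W.cX z.1 z.2.1 (z.2.2 0 0 0)
  τ z := W.cT z.1 z.2.1 (z.2.2 0 0 0)
  η _ z := W.cU z.1 z.2.1 (z.2.2 0 0 0)

/-- `W` generates a point symmetry of the scalar equation `S`: the prolongation of `W`
annihilates the equation wherever the equation holds. -/
def PointField.IsPointSymmetryOf (W : PointField) (S : PDESystem 1 1) : Prop :=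
  ∀ z ∈ S.dom, S.eq 0 z = 0 → W.toVField.prolong (S.eq 0) z = 0

/-! ### The two systems -/

/-- The potential system `v_x = u_t`, `v_t = c(u)² u_x` of the nonlinear wave equation
`u_tt = (c(u)² u_x)_x`; the values of `u` lie in the set `I` on which `c` is considered.
Here `u` is the dependent variable `0` and `v` is the dependent variable `1`. -/
def potentialSystem (I : Set ℝ) (c : ℝ → ℝ) : PDESystem 2 2 where
  dom := {z | z.2.2 0 0 0 ∈ I}
  eq := ![fun z => z.2.2 1 1 0 - z.2.2 0 0 1,
          fun z => z.2.2 1 0 1 - c (z.2.2 0 0 0) ^ 2 * z.2.2 0 1 0]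

/-- The scalar equation for `U(X, T)`
`U_TT + c²(T) (c²(T) U_XX - U_XX U_T² - U_TT U_X² - 2 U_TX + 2 U_TX U_T U_X)
  - 2 c(T) c'(T) (U_X - U_X² U_T) = 0`, for `T` in the set `I`. -/
def scalarEquation (I : Set ℝ) (c : ℝ → ℝ) : PDESystem 1 1 where
  dom := {z | z.2.1 ∈ I}
  eq := fun _ z =>
    let T := z.2.1
    let UX := z.2.2 0 1 0
    let UT := z.2.2 0 0 1
    let UXX := z.2.2 0 2 0
    let UTX := z.2.2 0 1 1
    let UTT := z.2.2 0 0 2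
    UTT + c T ^ 2 * (c T ^ 2 * UXX - UXX * UT ^ 2 - UTT * UX ^ 2 - 2 * UTX + 2 * UTX * UT * UX)
      - 2 * c T * deriv c T * (UX - UX ^ 2 * UT)

/-! ### Tracing a point symmetry back to the potential system

The variables are related by `X = x`, `T = u`, `U = t + v` (and `V = v`). The vector fields
`ξ ∂_x + τ ∂_t + η ∂_u + φ ∂_v` that induce `W` on the variables `(X, T, U)` are those with
`ξ = cX(x, u, t + v)`, `η = cT(x, u, t + v)` and `τ + φ = cU(x, u, t + v)`, so that they are
determined by `W` and by the component `τ = f`. -/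

/-- The generalized vector field on `(x, t, u, v)` that induces `W` on `(X, T, U)` and has the
component `f` along `∂_t`. -/
def PointField.lift (W : PointField) (f : Jet 2 → ℝ) : VField 2 where
  ξ z := W.cX z.1 (z.2.2 0 0 0) (z.2.1 + z.2.2 1 0 0)
  τ := f
  η := ![fun z => W.cT z.1 (z.2.2 0 0 0) (z.2.1 + z.2.2 1 0 0),
         fun z => W.cU z.1 (z.2.2 0 0 0) (z.2.1 + z.2.2 1 0 0) - f z]

/-- `W` yields a local symmetry of the potential system: for some differential function `f`,
given over an open set of finite jets that meets the system, the lift of `W` with `∂_t`-component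
`f` is a local symmetry. -/
def YieldsLocalSymmetry (I : Set ℝ) (c : ℝ → ℝ) (W : PointField) : Prop :=
  ∃ (n : ℕ) (Ω : Set (FinJet 2 n)) (f : Jet 2 → ℝ),
    IsOpen Ω ∧ (∃ z ∈ (potentialSystem I c).prolonged, truncate n z ∈ Ω) ∧
    IsDifferentialFunctionOn Ω f ∧
    (potentialSystem I c).IsLocalSymmetryOn Ω (W.lift f)

/-- `W` yields a (local or nonlocal) symmetry of the potential system: along every smooth solution
`(u, v)` on an open convex set there is a function `f` such that the lift of `W` with
`∂_t`-component `f` is, in evolutionary form, an infinitesimal deformation through solutions. -/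
def YieldsSymmetry (I : Set ℝ) (c : ℝ → ℝ) (W : PointField) : Prop :=
  ∀ (D : Set (ℝ × ℝ)) (w : Fin 2 → ℝ × ℝ → ℝ), IsOpen D → Convex ℝ D →
    (potentialSystem I c).IsSolutionOn D w →
    ∃ f : ℝ × ℝ → ℝ, ContDiffOn ℝ ∞ f D ∧
      (potentialSystem I c).IsInfinitesimalDeformation D w
        (fun α p => (W.lift (fun _ => f p)).char α (jetOf w p))

/-- `W` is a point symmetry of the scalar equation that yields a nonlocal symmetry of the
potential system. -/
def YieldsNonlocalSymmetry (I : Set ℝ) (c : ℝ → ℝ) (W : PointField) : Prop :=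
  W.IsPointSymmetryOf (scalarEquation I c) ∧ YieldsSymmetry I c W ∧ ¬ YieldsLocalSymmetry I c W

/-! ### The two symmetries -/

/-- `W₆ = U² ∂_U + T U ∂_T - (U / T³) ∂_X`. -/
def W₆ : PointField where
  cX _ T U := -(U / T ^ 3)
  cT _ T U := T * U
  cU _ _ U := U ^ 2

/-- `W₇ = (X T - 3 T^(2/3)) ∂_T + (X T^(-1/3) - X² / 3) ∂_X`. -/
def W₇ : PointField where
  cX X T _ := X * T ^ (-(1 / 3) : ℝ) - X ^ 2 / 3
  cT X T _ := X * T - 3 * T ^ (2 / 3 : ℝ)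
  cU _ _ _ := 0

end NonlocalSymm

end

noncomputable section

namespace NonlocalSymm

open Filter Topology

/-! ### Calculus on the jet space -/

/-! For a given point field the lift to (P) has one unknown, the component `f`. In the linearization
of (P) at a solution the value of `f` cancels, and what remains is a homogeneous linear system for
`(f_x - P, f_t - R)` with explicit `P`, `R` and with determinant `(1 + c² u_x)² - c² v_x²`
(`LinearizedReduction`). Thus `f_x = P`, `f_t = R` always suffices, and `D_x f = P` is forced
wherever the determinant is nonzero.

Existence: for `W₆` the form `P dx + R dt` is `d(u⁻²/2 + 3(t+v)²/2) - (u dx + (t+v) dt)`, and for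
`W₇` it is `-d(xv/3) + (v dx - 3u^(-1/3) dt)/3`. The forms `u dx + (t+v) dt` and `v dx - 3u^(-1/3)
dt` are closed by (P), so the Poincaré lemma `exists_potential` on the convex domain gives `f`.

Nonlocality: if `f` were a differential function, subtracting the exact part would leave a
differential function `F` with `D_x F = κ u` or `D_x F = κ v`, `κ ≠ 0`, on solution jets with
nonzero determinant. `no_potential` excludes this. Eliminating the `t`-derivatives by (P) makes `F`
a function of finitely many `x`-derivatives. Along the `x`-jets of a pair of functions on an
interval, the increment of `F` is then `κ` times the integral of one of them, but a perturbation
that is flat at both ends changes this integral without changing the end jets.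

That `W₆` and `W₇` are point symmetries of (S) is a direct computation: the prolongation applied to
the equation is an explicit multiple of the equation. -/

/-- The direction of the total derivative `D_x`. -/
def shiftX {m : ℕ} (z : Jet m) : Jet m := (1, 0, fun α i j => z.2.2 α (i + 1) j)

/-- The direction of the total derivative `D_t`. -/
def shiftT {m : ℕ} (z : Jet m) : Jet m := (0, 1, fun α i j => z.2.2 α i (j + 1))

/-- All jet coordinates of the curve `γ` are differentiable at `s`, with derivative `v`. -/
def HasJetDerivAt {m : ℕ} (γ : ℝ → Jet m) (v : Jet m) (s : ℝ) : Prop :=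
  HasDerivAt (fun r => (γ r).1) v.1 s ∧ HasDerivAt (fun r => (γ r).2.1) v.2.1 s ∧
    ∀ α i j, HasDerivAt (fun r => (γ r).2.2 α i j) (v.2.2 α i j) s

lemma hasJetDerivAt_line {m : ℕ} (z v : Jet m) :
    HasJetDerivAt (fun s : ℝ => z + s • v) v 0 := by
  refine ⟨?_, ?_, fun α i j => ?_⟩
  · simpa using ((hasDerivAt_id (0 : ℝ)).mul_const v.1).const_add z.1
  · simpa using ((hasDerivAt_id (0 : ℝ)).mul_const v.2.1).const_add z.2.1
  · simpa using ((hasDerivAt_id (0 : ℝ)).mul_const (v.2.2 α i j)).const_add (z.2.2 α i j)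

lemma HasJetDerivAt.truncate {m : ℕ} {γ : ℝ → Jet m} {v : Jet m} {s : ℝ}
    (h : HasJetDerivAt γ v s) (n : ℕ) :
    HasDerivAt (fun r => truncate n (γ r)) (truncate n v) s := by
  refine h.1.prodMk (h.2.1.prodMk ?_)
  refine hasDerivAt_pi.2 fun α => hasDerivAt_pi.2 fun i => hasDerivAt_pi.2 fun j => ?_
  exact h.2.2 α i j

lemma continuous_truncate {m : ℕ} (n : ℕ) : Continuous (truncate n : Jet m → FinJet m n) := by
  unfold truncate
  fun_prop

section DifferentialFunctions

variable {m n : ℕ} {Ω : Set (FinJet m n)} {F : Jet m → ℝ}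

lemma IsDifferentialFunctionOn.exists_hasDerivAt (hΩ : IsOpen Ω)
    {G : FinJet m n → ℝ} (hG : ContDiffOn ℝ ∞ G Ω)
    (hFG : ∀ z : Jet m, NonlocalSymm.truncate n z ∈ Ω → F z = G (NonlocalSymm.truncate n z))
    {γ : ℝ → Jet m} {v : Jet m} {s : ℝ} (h : HasJetDerivAt γ v s)
    (hs : NonlocalSymm.truncate n (γ s) ∈ Ω) :
    HasDerivAt (fun r => F (γ r))
      (fderiv ℝ G (NonlocalSymm.truncate n (γ s)) (NonlocalSymm.truncate n v)) s := by
  have hγ := h.truncate n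
  have hG' : HasFDerivAt G (fderiv ℝ G (NonlocalSymm.truncate n (γ s)))
      (NonlocalSymm.truncate n (γ s)) :=
    ((hG.contDiffAt (hΩ.mem_nhds hs)).differentiableAt (by simp)).hasFDerivAt
  refine (hG'.comp_hasDerivAt s hγ).congr_of_eventuallyEq ?_
  filter_upwards [hγ.continuousAt.preimage_mem_nhds (hΩ.mem_nhds hs)] with r hr
  exact hFG _ hr

lemma IsDifferentialFunctionOn.lineDeriv_eq (hΩ : IsOpen Ω)
    {G : FinJet m n → ℝ} (hG : ContDiffOn ℝ ∞ G Ω)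
    (hFG : ∀ z : Jet m, NonlocalSymm.truncate n z ∈ Ω → F z = G (NonlocalSymm.truncate n z))
    {z : Jet m} (v : Jet m) (hz : NonlocalSymm.truncate n z ∈ Ω) :
    lineDeriv ℝ F z v
      = fderiv ℝ G (NonlocalSymm.truncate n z) (NonlocalSymm.truncate n v) := by
  have := exists_hasDerivAt hΩ hG hFG (hasJetDerivAt_line z v) (by simpa using hz)
  simpa [lineDeriv] using this.deriv

/-- The chain rule for a differential function along a curve of jets. -/
lemma IsDifferentialFunctionOn.hasDerivAt_comp (hF : IsDifferentialFunctionOn Ω F)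
    (hΩ : IsOpen Ω) {γ : ℝ → Jet m} {v : Jet m} {s : ℝ} (h : HasJetDerivAt γ v s)
    (hs : NonlocalSymm.truncate n (γ s) ∈ Ω) :
    HasDerivAt (fun r => F (γ r)) (lineDeriv ℝ F (γ s) v) s := by
  obtain ⟨G, hG, hFG⟩ := hF
  rw [lineDeriv_eq hΩ hG hFG v hs]
  exact exists_hasDerivAt hΩ hG hFG h hs

lemma IsDifferentialFunctionOn.hasDerivAt_line (hF : IsDifferentialFunctionOn Ω F)
    (hΩ : IsOpen Ω) {z : Jet m} (v : Jet m) (hz : NonlocalSymm.truncate n z ∈ Ω) :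
    HasDerivAt (fun s : ℝ => F (z + s • v)) (lineDeriv ℝ F z v) 0 := by
  have := hF.hasDerivAt_comp hΩ (hasJetDerivAt_line z v) (by simpa using hz)
  simpa using this

lemma IsDifferentialFunctionOn.mono {Ω' : Set (FinJet m n)} (hF : IsDifferentialFunctionOn Ω F)
    (h : Ω' ⊆ Ω) : IsDifferentialFunctionOn Ω' F := by
  obtain ⟨G, hG, hFG⟩ := hF
  exact ⟨G, hG.mono h, fun z hz => hFG z (h hz)⟩

/-- Forget the coordinates of order `n + 1`. -/
def restrictJet (y : FinJet m (n + 1)) : FinJet m n :=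
  (y.1, y.2.1, fun α i j => y.2.2 α i.castSucc j.castSucc)

lemma contDiff_restrictJet : ContDiff ℝ ∞ (restrictJet : FinJet m (n + 1) → FinJet m n) := by
  unfold restrictJet
  fun_prop

/-- By the chain rule, `D_x F` is the differential of `G` applied to the shifted coordinates. The
shift reaches one order higher, hence `n + 1` and the pullback of `Ω`. -/
lemma IsDifferentialFunctionOn.totalX (hF : IsDifferentialFunctionOn Ω F) (hΩ : IsOpen Ω) :
    IsDifferentialFunctionOn (restrictJet ⁻¹' Ω) (NonlocalSymm.totalX F) := by
  obtain ⟨G, hG, hFG⟩ := hF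
  refine ⟨fun y => fderiv ℝ G (restrictJet y)
    ((1, 0, fun α i j => y.2.2 α i.succ j.castSucc) : FinJet m n), ?_, fun z hz => ?_⟩
  · have h1 : ContDiffOn ℝ ∞ (fderiv ℝ G) Ω := hG.fderiv_of_isOpen hΩ (by simp)
    refine (h1.comp contDiff_restrictJet.contDiffOn (fun y hy => hy)).clm_apply ?_
    fun_prop
  · exact lineDeriv_eq hΩ hG hFG (shiftX z) hz

lemma IsDifferentialFunctionOn.totalT (hF : IsDifferentialFunctionOn Ω F) (hΩ : IsOpen Ω) :
    IsDifferentialFunctionOn (restrictJet ⁻¹' Ω) (NonlocalSymm.totalT F) := by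
  obtain ⟨G, hG, hFG⟩ := hF
  refine ⟨fun y => fderiv ℝ G (restrictJet y)
    ((0, 1, fun α i j => y.2.2 α i.castSucc j.succ) : FinJet m n), ?_, fun z hz => ?_⟩
  · have h1 : ContDiffOn ℝ ∞ (fderiv ℝ G) Ω := hG.fderiv_of_isOpen hΩ (by simp)
    refine (h1.comp contDiff_restrictJet.contDiffOn (fun y hy => hy)).clm_apply ?_
    fun_prop
  · exact lineDeriv_eq hΩ hG hFG (shiftT z) hz

end DifferentialFunctions

/-- The finite jets of pairs `(u, v)` with `u ∈ I`. -/
def valueIn (I : Set ℝ) (n : ℕ) : Set (FinJet 2 n) := {y | y.2.2 0 0 0 ∈ I}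

lemma isOpen_valueIn {I : Set ℝ} (hI : IsOpen I) (n : ℕ) : IsOpen (valueIn I n) :=
  hI.preimage (by fun_prop)

/-- Differential functions given over all jets of pairs `(u, v)` with `u ∈ I`. -/
def IsDifferentialFunctionOver (I : Set ℝ) (F : Jet 2 → ℝ) : Prop :=
  ∃ n, IsDifferentialFunctionOn (valueIn I n) F

section Over

variable {I : Set ℝ} {F : Jet 2 → ℝ}

lemma IsDifferentialFunctionOver.totalX (hF : IsDifferentialFunctionOver I F) (hI : IsOpen I) :
    IsDifferentialFunctionOver I (NonlocalSymm.totalX F) := by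
  obtain ⟨n, hF⟩ := hF
  exact ⟨n + 1, hF.totalX (isOpen_valueIn hI n)⟩

lemma IsDifferentialFunctionOver.totalT (hF : IsDifferentialFunctionOver I F) (hI : IsOpen I) :
    IsDifferentialFunctionOver I (NonlocalSymm.totalT F) := by
  obtain ⟨n, hF⟩ := hF
  exact ⟨n + 1, hF.totalT (isOpen_valueIn hI n)⟩

lemma IsDifferentialFunctionOver.iterate (hF : IsDifferentialFunctionOver I F) (hI : IsOpen I)
    (i j : ℕ) :
    IsDifferentialFunctionOver I (NonlocalSymm.totalX^[i] (NonlocalSymm.totalT^[j] F)) := by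
  have h1 : IsDifferentialFunctionOver I (NonlocalSymm.totalT^[j] F) := by
    induction j with
    | zero => exact hF
    | succ j ih => rw [Function.iterate_succ_apply']; exact ih.totalT hI
  induction i with
  | zero => exact h1
  | succ i ih => rw [Function.iterate_succ_apply']; exact ih.totalX hI

lemma IsDifferentialFunctionOver.hasDerivAt_comp (hF : IsDifferentialFunctionOver I F)
    (hI : IsOpen I) {γ : ℝ → Jet 2} {v : Jet 2} {s : ℝ} (h : HasJetDerivAt γ v s)
    (hs : (γ s).2.2 0 0 0 ∈ I) :
    HasDerivAt (fun r => F (γ r)) (lineDeriv ℝ F (γ s) v) s := by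
  obtain ⟨n, hF⟩ := hF
  exact hF.hasDerivAt_comp (isOpen_valueIn hI n) h hs

lemma IsDifferentialFunctionOver.continuousOn (hF : IsDifferentialFunctionOver I F) :
    ContinuousOn F {z : Jet 2 | z.2.2 0 0 0 ∈ I} := by
  obtain ⟨n, G, hG, hFG⟩ := hF
  refine ContinuousOn.congr (f := fun z => G (truncate n z)) ?_ fun z hz => hFG z hz
  exact hG.continuousOn.comp (continuous_truncate n).continuousOn fun z hz => hz

end Over

/-! ### The solution manifold of the potential system -/

/-- The right-hand side `c²(u) u_x` of the second equation of the potential system. -/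
def flux (c : ℝ → ℝ) (z : Jet 2) : ℝ := c (z.2.2 0 0 0) ^ 2 * z.2.2 0 1 0

lemma isDifferentialFunctionOn_flux {I : Set ℝ} {c : ℝ → ℝ} (hc : ContDiffOn ℝ ∞ c I) :
    IsDifferentialFunctionOn (valueIn I 1) (flux c) := by
  refine ⟨fun y => c (y.2.2 0 0 0) ^ 2 * y.2.2 0 1 0, ?_, fun z hz => rfl⟩
  refine ContDiffOn.mul (ContDiffOn.pow ?_ 2) (by fun_prop)
  exact hc.comp (t := I) (f := fun y : FinJet 2 1 => y.2.2 0 0 0) (by fun_prop) fun y hy => hy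

lemma isDifferentialFunctionOver_flux {I : Set ℝ} {c : ℝ → ℝ} (hc : ContDiffOn ℝ ∞ c I) :
    IsDifferentialFunctionOver I (flux c) := ⟨1, isDifferentialFunctionOn_flux hc⟩

lemma iterate_total_coord_sub_coord {m : ℕ} (α β : Fin m) (a b k l i j : ℕ) :
    totalX^[i] (totalT^[j] (fun z : Jet m => z.2.2 α a b - z.2.2 β k l))
      = fun z => z.2.2 α (a + i) (b + j) - z.2.2 β (k + i) (l + j) := by
  have h1 : totalT^[j] (fun z : Jet m => z.2.2 α a b - z.2.2 β k l)
      = fun z => z.2.2 α a (b + j) - z.2.2 β k (l + j) := by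
    induction j with
    | zero => rfl
    | succ j ih =>
      rw [Function.iterate_succ_apply', ih]
      funext z
      simp [totalT, lineDeriv, add_assoc]
  rw [h1]
  induction i with
  | zero => rfl
  | succ i ih =>
    rw [Function.iterate_succ_apply', ih]
    funext z
    simp [totalX, lineDeriv, add_assoc]

section

variable {I : Set ℝ} {c : ℝ → ℝ}

lemma lineDeriv_coord_sub (hI : IsOpen I) {F H : Jet 2 → ℝ} (hH : IsDifferentialFunctionOver I H)
    {α : Fin 2} {i j : ℕ} (hF : ∀ z : Jet 2, z.2.2 0 0 0 ∈ I → F z = z.2.2 α i j - H z)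
    {z : Jet 2} (v : Jet 2) (hz : z.2.2 0 0 0 ∈ I) :
    lineDeriv ℝ F z v = v.2.2 α i j - lineDeriv ℝ H z v := by
  have h := hasJetDerivAt_line z v
  have h1 := (h.2.2 α i j).sub (hH.hasDerivAt_comp hI h (by simpa using hz))
  have h2 : (fun s : ℝ => F (z + s • v)) =ᶠ[𝓝 0]
      fun s => (z + s • v).2.2 α i j - H (z + s • v) := by
    have := (h.2.2 0 0 0).continuousAt.preimage_mem_nhds (hI.mem_nhds (by simpa using hz))
    filter_upwards [this] with s hs using hF _ hs
  simpa [lineDeriv] using (h1.congr_of_eventuallyEq h2).deriv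

lemma iterate_total_coord_sub (hI : IsOpen I) {H : Jet 2 → ℝ}
    (hH : IsDifferentialFunctionOver I H) (α : Fin 2) (a b i j : ℕ) {z : Jet 2}
    (hz : z.2.2 0 0 0 ∈ I) :
    (totalX^[i] (totalT^[j] (fun z : Jet 2 => z.2.2 α a b - H z))) z
      = z.2.2 α (a + i) (b + j) - (totalX^[i] (totalT^[j] H)) z := by
  have h1 : ∀ z : Jet 2, z.2.2 0 0 0 ∈ I →
      (totalT^[j] (fun z : Jet 2 => z.2.2 α a b - H z)) z
        = z.2.2 α a (b + j) - (totalT^[j] H) z := by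
    induction j with
    | zero => exact fun z _ => rfl
    | succ j ih =>
      intro z hz
      rw [Function.iterate_succ_apply', Function.iterate_succ_apply']
      exact lineDeriv_coord_sub hI (hH.iterate hI 0 j) ih (shiftT z) hz
  induction i generalizing z with
  | zero => exact h1 z hz
  | succ i ih =>
    rw [Function.iterate_succ_apply', Function.iterate_succ_apply']
    exact lineDeriv_coord_sub hI (hH.iterate hI i j) (fun z hz => ih hz) (shiftX z) hz

/-- The equations of the potential system and all their differential consequences, solved for
the leading derivatives. -/
lemma mem_prolonged_iff (hI : IsOpen I) (hc : ContDiffOn ℝ ∞ c I) {z : Jet 2} :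
    z ∈ (potentialSystem I c).prolonged ↔ z.2.2 0 0 0 ∈ I ∧
      ∀ i j, z.2.2 0 i (j + 1) = z.2.2 1 (i + 1) j ∧
        z.2.2 1 i (j + 1) = (totalX^[i] (totalT^[j] (flux c))) z := by
  have h0 : (potentialSystem I c).eq 0 = fun z => z.2.2 1 1 0 - z.2.2 0 0 1 := rfl
  have h1 : (potentialSystem I c).eq 1 = fun z => z.2.2 1 0 1 - flux c z := rfl
  refine and_congr_right fun hz => ?_
  rw [Fin.forall_fin_two, ← forall_and]
  refine forall_congr' fun i => ?_
  rw [← forall_and]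
  refine forall_congr' fun j => ?_
  rw [h0, h1, iterate_total_coord_sub_coord,
    iterate_total_coord_sub hI (isDifferentialFunctionOver_flux hc) _ _ _ _ _ hz]
  simp only [sub_eq_zero, zero_add, add_comm 1]
  exact and_congr_left' eq_comm

end

/-! ### Formal solutions -/

/-- The jet with the `x`-derivatives of `z`, whose `t`-derivatives are determined by the potential
system up to the order `J` and vanish from there on. -/
def extend (c : ℝ → ℝ) : ℕ → Jet 2 → Jet 2
  | 0, z => (z.1, z.2.1, fun α i j => if j = 0 then z.2.2 α i 0 else 0)
  | J + 1, z => (z.1, z.2.1, fun α i j =>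
      if j = J + 1 then
        (if α = 0 then (extend c J z).2.2 1 (i + 1) J
          else (totalX^[i] (totalT^[J] (flux c))) (extend c J z))
      else (extend c J z).2.2 α i j)

/-- The jet that has the `x`-derivatives of `z`, and the `t`-derivatives determined by them and
the potential system. -/
def formalSolution (c : ℝ → ℝ) (z : Jet 2) : Jet 2 :=
  (z.1, z.2.1, fun α i j => (extend c j z).2.2 α i j)

section

variable {I : Set ℝ} {c : ℝ → ℝ}

@[simp] lemma extend_fst (J : ℕ) (z : Jet 2) : (extend c J z).1 = z.1 := by
  cases J <;> rfl

@[simp] lemma extend_snd_fst (J : ℕ) (z : Jet 2) : (extend c J z).2.1 = z.2.1 := by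
  cases J <;> rfl

lemma extend_coord_of_le {j J : ℕ} (h : j ≤ J) (z : Jet 2) (α : Fin 2) (i : ℕ) :
    (extend c J z).2.2 α i j = (extend c j z).2.2 α i j := by
  induction J with
  | zero => obtain rfl : j = 0 := by omega
            rfl
  | succ J ih =>
    rcases h.eq_or_lt with rfl | h
    · rfl
    · rw [← ih (by omega)]
      simp [extend, h.ne]

lemma extend_coord_zero (J : ℕ) (z : Jet 2) (α : Fin 2) (i : ℕ) :
    (extend c J z).2.2 α i 0 = z.2.2 α i 0 := by
  rw [extend_coord_of_le (Nat.zero_le J)]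
  simp [extend]

lemma formalSolution_coord_zero (z : Jet 2) (α : Fin 2) (i : ℕ) :
    (formalSolution c z).2.2 α i 0 = z.2.2 α i 0 :=
  extend_coord_zero (c := c) 0 z α i

/-- The jets `z` and `z'` have the same derivatives of `t`-order at most `J`. -/
def AgreeTo (J : ℕ) (z z' : Jet 2) : Prop :=
  z.1 = z'.1 ∧ z.2.1 = z'.2.1 ∧ ∀ α i j, j ≤ J → z.2.2 α i j = z'.2.2 α i j

/-- The flux contains no `t`-derivatives, `D_x` preserves the `t`-order and `D_t` raises it by one.
Since total derivatives are line derivatives, agreement of the two lines is enough and no smoothness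
enters. Consequently the zeros that `extend` puts into the higher `t`-orders are never seen by the
recursion. -/
lemma iterate_total_flux_congr {i j : ℕ} {z z' : Jet 2} (h : AgreeTo j z z') :
    (totalX^[i] (totalT^[j] (flux c))) z = (totalX^[i] (totalT^[j] (flux c))) z' := by
  have h1 : ∀ z z', AgreeTo j z z' → (totalT^[j] (flux c)) z = (totalT^[j] (flux c)) z' := by
    clear h z z'
    induction j with
    | zero => intro z z' h
              simp [flux, h.2.2]
    | succ j ih =>
      intro z z' h
      rw [Function.iterate_succ_apply']
      simp only [totalT, lineDeriv]
      congr 1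
      funext s
      refine ih _ _ ⟨by simp [h.1], by simp [h.2.1], fun α i k hk => ?_⟩
      simp [h.2.2 α i k (by omega), h.2.2 α i (k + 1) (by omega)]
  induction i generalizing z z' with
  | zero => exact h1 _ _ h
  | succ i ih =>
    rw [Function.iterate_succ_apply']
    simp only [totalX, lineDeriv]
    congr 1
    funext s
    refine ih ⟨by simp [h.1], by simp [h.2.1], fun α i k hk => ?_⟩
    simp [h.2.2 α _ k hk]

lemma agreeTo_extend_formalSolution (J : ℕ) (z : Jet 2) :
    AgreeTo J (extend c J z) (formalSolution c z) :=
  ⟨by simp [formalSolution], by simp [formalSolution], fun α i _ hj =>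
    extend_coord_of_le hj z α i⟩

/-- The `x`-derivatives are free parameters on the solution manifold. Local symmetries are tested on
formal jets, so no existence theorem for actual solutions is needed. -/
lemma formalSolution_mem_prolonged (hI : IsOpen I) (hc : ContDiffOn ℝ ∞ c I) {z : Jet 2}
    (hz : z.2.2 0 0 0 ∈ I) : formalSolution c z ∈ (potentialSystem I c).prolonged := by
  refine (mem_prolonged_iff hI hc).2 ⟨hz, fun i j => ⟨?_, ?_⟩⟩
  · simp [formalSolution, extend]
  · rw [← iterate_total_flux_congr (agreeTo_extend_formalSolution j z)]
    simp [formalSolution, extend]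

/-- Induction on the `t`-order: `mem_prolonged_iff` expresses order `J + 1` through orders at most
`J`, exactly as `extend` does. -/
lemma formalSolution_eq_self (hI : IsOpen I) (hc : ContDiffOn ℝ ∞ c I) {z : Jet 2}
    (hz : z ∈ (potentialSystem I c).prolonged) : formalSolution c z = z := by
  obtain ⟨-, h⟩ := (mem_prolonged_iff hI hc).1 hz
  have key : ∀ J, AgreeTo J (extend c J z) z := by
    intro J
    induction J with
    | zero =>
      refine ⟨rfl, rfl, fun α i j hj => ?_⟩
      obtain rfl : j = 0 := by omega
      simp [extend]
    | succ J ih =>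
      refine ⟨rfl, rfl, fun α i j hj => ?_⟩
      rcases hj.eq_or_lt with rfl | hj
      · fin_cases α
        · simp [extend, (h i J).1, ih.2.2 1 (i + 1) J le_rfl]
        · simp [extend, (h i J).2, iterate_total_flux_congr ih]
      · rw [← ih.2.2 α i j (by omega)]
        simp [extend, hj.ne]
  refine Prod.ext rfl (Prod.ext rfl ?_)
  funext α i j
  exact (key j).2.2 α i j le_rfl

lemma continuousOn_extend (hI : IsOpen I) (hc : ContDiffOn ℝ ∞ c I) (J : ℕ) :
    ContinuousOn (extend c J) {z : Jet 2 | z.2.2 0 0 0 ∈ I} := by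
  have hfst : Continuous fun z : Jet 2 => z.1 := by fun_prop
  have hsnd : Continuous fun z : Jet 2 => z.2.1 := by fun_prop
  induction J with
  | zero =>
    refine hfst.continuousOn.prodMk (hsnd.continuousOn.prodMk ?_)
    refine continuousOn_pi.2 fun α => continuousOn_pi.2 fun i => continuousOn_pi.2 fun j => ?_
    by_cases hj : j = 0
    · simp only [hj, if_true]; fun_prop
    · simp only [hj, if_false]; fun_prop
  | succ J ih =>
    refine hfst.continuousOn.prodMk (hsnd.continuousOn.prodMk ?_)
    have hco : ∀ α i j, ContinuousOn (fun z => (extend c J z).2.2 α i j)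
        {z : Jet 2 | z.2.2 0 0 0 ∈ I} := fun α i j =>
      Continuous.comp_continuousOn (g := fun z : Jet 2 => z.2.2 α i j) (by fun_prop) ih
    refine continuousOn_pi.2 fun α => continuousOn_pi.2 fun i => continuousOn_pi.2 fun j => ?_
    by_cases hj : j = J + 1
    · simp only [hj, if_true]
      by_cases hα : α = 0
      · simp only [hα, if_true]
        exact hco _ _ _
      · simp only [hα, if_false]
        refine ContinuousOn.comp
          (((isDifferentialFunctionOver_flux hc).iterate hI i J).continuousOn) ih fun z hz => ?_
        simpa [extend_coord_zero] using hz
    · simp only [hj, if_false]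
      exact hco _ _ _

lemma continuousOn_formalSolution (hI : IsOpen I) (hc : ContDiffOn ℝ ∞ c I) :
    ContinuousOn (formalSolution c) {z : Jet 2 | z.2.2 0 0 0 ∈ I} := by
  refine ContinuousOn.prodMk (by fun_prop) (ContinuousOn.prodMk (by fun_prop) ?_)
  refine continuousOn_pi.2 fun α => continuousOn_pi.2 fun i => continuousOn_pi.2 fun j => ?_
  exact Continuous.comp_continuousOn (g := fun z : Jet 2 => z.2.2 α i j) (by fun_prop)
    (continuousOn_extend hI hc j)

lemma truncate_eq_iff {m n : ℕ} {z z' : Jet m} :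
    truncate n z = truncate n z' ↔ z.1 = z'.1 ∧ z.2.1 = z'.2.1 ∧
      ∀ α i j, i ≤ n → j ≤ n → z.2.2 α i j = z'.2.2 α i j := by
  constructor
  · intro h
    refine ⟨congrArg (fun y => y.1) h, congrArg (fun y => y.2.1) h, fun α i j hi hj => ?_⟩
    exact congrArg (fun y => y.2.2 α ⟨i, by omega⟩ ⟨j, by omega⟩) h
  · rintro ⟨h1, h2, h3⟩
    refine Prod.ext h1 (Prod.ext h2 ?_)
    funext α i j
    exact h3 α i j (by omega) (by omega)

/-- Finitely many `x`-derivatives of `z` determine a finite jet of `extend c J z`. -/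
lemma exists_truncate_extend_eq (hI : IsOpen I) (hc : ContDiffOn ℝ ∞ c I) (J n : ℕ) :
    ∃ M, ∀ z z' : Jet 2, z.2.2 0 0 0 ∈ I →
      truncate M (extend c 0 z) = truncate M (extend c 0 z') →
      truncate n (extend c J z) = truncate n (extend c J z') := by
  induction J generalizing n with
  | zero => exact ⟨n, fun _ _ _ h => h⟩
  | succ J ih =>
    choose N hN using fun i => (isDifferentialFunctionOver_flux hc).iterate hI i J
    -- `K` has to bound the orders `N i`, `i ≤ n`, of the iterated derivatives of the flux, the
    -- shifted index `i + 1`, the order `n` of the untouched coordinates, and the `t`-order `J`.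
    set K := (Finset.range (n + 1)).sup N + n + 1 + J with hK
    obtain ⟨M, hM⟩ := ih K
    refine ⟨M, fun z z' hz h => ?_⟩
    have hu : z.2.2 0 0 0 = z'.2.2 0 0 0 := by
      simpa [extend] using (truncate_eq_iff.1 h).2.2 0 0 0 (by omega) (by omega)
    have h' := truncate_eq_iff.1 (hM z z' hz h)
    refine truncate_eq_iff.2 ⟨by simpa using h'.1, by simpa using h'.2.1, fun α i j hi hj => ?_⟩
    by_cases hJ : j = J + 1
    · subst hJ
      by_cases hα : α = 0
      · simpa [extend, hα] using h'.2.2 1 (i + 1) J (by omega) (by omega)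
      · simp only [extend, hα, if_true, if_false]
        obtain ⟨G, -, hG⟩ := hN i
        have hNi : N i ≤ K := by
          have := Finset.le_sup (f := N) (Finset.mem_range.2 (Nat.lt_add_one_of_le hi))
          omega
        rw [hG _ (by simpa [valueIn, truncate, extend_coord_zero] using hz),
          hG _ (by simpa [valueIn, truncate, extend_coord_zero, ← hu] using hz)]
        congr 1
        exact truncate_eq_iff.2 ⟨h'.1, h'.2.1, fun α a b ha hb =>
          h'.2.2 α a b (ha.trans hNi) (hb.trans hNi)⟩
    · simpa [extend, hJ] using h'.2.2 α i j (by omega) (by omega)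

lemma exists_truncate_formalSolution_eq (hI : IsOpen I) (hc : ContDiffOn ℝ ∞ c I) (n : ℕ) :
    ∃ M, ∀ z z' : Jet 2, z.2.2 0 0 0 ∈ I →
      truncate M (extend c 0 z) = truncate M (extend c 0 z') →
      truncate n (formalSolution c z) = truncate n (formalSolution c z') := by
  obtain ⟨M, hM⟩ := exists_truncate_extend_eq hI hc n n
  refine ⟨M, fun z z' hz h => ?_⟩
  have h' := truncate_eq_iff.1 (hM z z' hz h)
  refine truncate_eq_iff.2 ⟨by simpa [formalSolution] using h'.1,
    by simpa [formalSolution] using h'.2.1, fun α i j hi hj => ?_⟩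
  have a1 := (agreeTo_extend_formalSolution (c := c) n z).2.2 α i j hj
  have a2 := (agreeTo_extend_formalSolution (c := c) n z').2.2 α i j hj
  rw [← a1, ← a2]
  exact h'.2.2 α i j hi hj

/-- A curve of jets that moves in the direction `D_x`, as far as the `x`-derivatives are concerned,
does so after extension to a formal solution. -/
lemma HasJetDerivAt.extend (hI : IsOpen I) (hc : ContDiffOn ℝ ∞ c I) {γ : ℝ → Jet 2} {s : ℝ}
    (hs : (γ s).2.2 0 0 0 ∈ I)
    (h : HasJetDerivAt (fun r => extend c 0 (γ r)) (shiftX (NonlocalSymm.extend c 0 (γ s))) s)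
    (J : ℕ) :
    HasJetDerivAt (fun r => NonlocalSymm.extend c J (γ r))
      (shiftX (NonlocalSymm.extend c J (γ s))) s := by
  induction J with
  | zero => exact h
  | succ J ih =>
    refine ⟨by simpa [shiftX] using ih.1, by simpa [shiftX] using ih.2.1, fun α i j => ?_⟩
    by_cases hj : j = J + 1
    · subst hj
      by_cases hα : α = 0
      · simpa [NonlocalSymm.extend, hα, shiftX] using ih.2.2 1 (i + 1) J
      · simp only [NonlocalSymm.extend, hα, if_true, if_false, shiftX]
        -- The line derivative in the direction `shiftX` is `D_x` itself, which supplies the next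
        -- iterate.
        rw [Function.iterate_succ_apply']
        exact ((isDifferentialFunctionOver_flux hc).iterate hI i J).hasDerivAt_comp hI ih
          (by simpa [extend_coord_zero] using hs)
    · simpa [NonlocalSymm.extend, hj, shiftX] using ih.2.2 α i j

lemma HasJetDerivAt.formalSolution (hI : IsOpen I) (hc : ContDiffOn ℝ ∞ c I) {γ : ℝ → Jet 2}
    {s : ℝ} (hs : (γ s).2.2 0 0 0 ∈ I)
    (h : HasJetDerivAt (fun r => NonlocalSymm.extend c 0 (γ r))
      (shiftX (NonlocalSymm.extend c 0 (γ s))) s) :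
    HasJetDerivAt (fun r => formalSolution c (γ r))
      (shiftX (NonlocalSymm.formalSolution c (γ s))) s :=
  ⟨by simpa [shiftX, NonlocalSymm.formalSolution] using h.1,
    by simpa [shiftX, NonlocalSymm.formalSolution] using h.2.1, fun α i j =>
    (h.extend hI hc hs j).2.2 α i j⟩

end

/-! ### Families of curves of jets with prescribed ends -/

/-- The derivative with respect to the second variable. -/
def partialSnd (g : ℝ × ℝ → ℝ) (q : ℝ × ℝ) : ℝ := fderiv ℝ g q (0, 1)

lemma ContDiff.partialSnd {g : ℝ × ℝ → ℝ} (hg : ContDiff ℝ ∞ g) :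
    ContDiff ℝ ∞ (partialSnd g) :=
  (hg.fderiv_right (m := ∞) (by simp)).clm_apply contDiff_const

lemma ContDiff.iterate_partialSnd {g : ℝ × ℝ → ℝ} (hg : ContDiff ℝ ∞ g) (i : ℕ) :
    ContDiff ℝ ∞ (NonlocalSymm.partialSnd^[i] g) := by
  induction i with
  | zero => exact hg
  | succ i ih => rw [Function.iterate_succ_apply']; exact ContDiff.partialSnd ih

lemma hasDerivAt_partialSnd {g : ℝ × ℝ → ℝ} (hg : ContDiff ℝ ∞ g) (h x : ℝ) :
    HasDerivAt (fun y => g (h, y)) (partialSnd g (h, x)) x := by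
  have h1 : HasFDerivAt g (fderiv ℝ g (h, x)) (h, x) :=
    (hg.differentiable (by simp) _).hasFDerivAt
  exact h1.comp_hasDerivAt x ((hasDerivAt_const x h).prodMk (hasDerivAt_id x))

/-- By the Leibniz rule each derivative costs at most one factor `ℓ`. This shows that `bump` is flat
to order `M` at both ends. -/
lemma iterate_partialSnd_pow_mul {ℓ r : ℝ × ℝ → ℝ} (hℓ : ContDiff ℝ ∞ ℓ) (hr : ContDiff ℝ ∞ r)
    (m i : ℕ) : ∃ r', ContDiff ℝ ∞ r' ∧
      partialSnd^[i] (fun q => ℓ q ^ (m + i) * r q) = fun q => ℓ q ^ m * r' q := by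
  induction i generalizing m with
  | zero => exact ⟨r, hr, rfl⟩
  | succ i ih =>
    obtain ⟨r', hr', h⟩ := ih (m + 1)
    refine ⟨fun q => (m + 1 : ℝ) * partialSnd ℓ q * r' q + ℓ q * partialSnd r' q, ?_, ?_⟩
    · exact ((contDiff_const.mul (ContDiff.partialSnd hℓ)).mul hr').add
        (hℓ.mul (ContDiff.partialSnd hr'))
    · rw [Function.iterate_succ_apply', show m + (i + 1) = m + 1 + i by ring, h]
      funext q
      obtain ⟨a, x⟩ := q
      have h1 := (((hasDerivAt_partialSnd hℓ a x).pow (m + 1)).mul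
        (hasDerivAt_partialSnd hr' a x))
      have h2 := hasDerivAt_partialSnd ((hℓ.pow (m + 1)).mul hr') a x
      rw [HasDerivAt.unique h2 h1]
      push_cast
      simp
      ring

lemma iterate_partialSnd_eq_zero {ℓ r : ℝ × ℝ → ℝ} (hℓ : ContDiff ℝ ∞ ℓ) (hr : ContDiff ℝ ∞ r)
    {M i : ℕ} (hi : i ≤ M) {q : ℝ × ℝ} (hq : ℓ q = 0) :
    partialSnd^[i] (fun q => ℓ q ^ (M + 1) * r q) q = 0 := by
  obtain ⟨r', -, h⟩ := iterate_partialSnd_pow_mul hℓ hr (M + 1 - i) i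
  rw [show M + 1 - i + i = M + 1 by omega] at h
  rw [h]
  simp [hq, show M + 1 - i ≠ 0 by omega]

/-- The function `(x - x₀)^(M+1) (x - x₀ - h)^(M+1)` of `(h, x)`. -/
def bump (x₀ : ℝ) (M : ℕ) (q : ℝ × ℝ) : ℝ := (q.2 - x₀) ^ (M + 1) * (q.2 - x₀ - q.1) ^ (M + 1)

lemma contDiff_bump (x₀ : ℝ) (M : ℕ) : ContDiff ℝ ∞ (bump x₀ M) := by
  unfold bump
  fun_prop

lemma iterate_partialSnd_bump_left (x₀ : ℝ) {M i : ℕ} (hi : i ≤ M) (h : ℝ) :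
    partialSnd^[i] (bump x₀ M) (h, x₀) = 0 :=
  iterate_partialSnd_eq_zero (ℓ := fun q => q.2 - x₀)
    (r := fun q => (q.2 - x₀ - q.1) ^ (M + 1)) (by fun_prop) (by fun_prop) hi (by simp)

lemma iterate_partialSnd_bump_right (x₀ : ℝ) {M i : ℕ} (hi : i ≤ M) (h : ℝ) :
    partialSnd^[i] (bump x₀ M) (h, x₀ + h) = 0 := by
  have : bump x₀ M = fun q => (q.2 - x₀ - q.1) ^ (M + 1) * (q.2 - x₀) ^ (M + 1) := by
    funext q
    simp [bump, mul_comm]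
  rw [this]
  exact iterate_partialSnd_eq_zero (ℓ := fun q => q.2 - x₀ - q.1)
    (r := fun q => (q.2 - x₀) ^ (M + 1)) (by fun_prop) (by fun_prop) hi (by simp)

/-- The `i`-th derivative of the Taylor polynomial `∑_{k ≤ M} a k (x - x₀)^k / k!`. -/
def taylorSum (x₀ : ℝ) (M : ℕ) (a : ℕ → ℝ) (i : ℕ) (x : ℝ) : ℝ :=
  ∑ k ∈ Finset.range (M + 1),
    if i ≤ k then a k * ((x - x₀) ^ (k - i) / (k - i).factorial) else 0

lemma hasDerivAt_taylorSum (x₀ : ℝ) (M : ℕ) (a : ℕ → ℝ) (i : ℕ) (x : ℝ) :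
    HasDerivAt (taylorSum x₀ M a i) (taylorSum x₀ M a (i + 1) x) x := by
  unfold taylorSum
  refine HasDerivAt.fun_sum fun k _ => ?_
  by_cases h : i + 1 ≤ k
  · obtain ⟨l, rfl⟩ := Nat.exists_eq_add_of_le h
    simp only [show i ≤ i + 1 + l by omega, h, if_true, show i + 1 + l - i = l + 1 by omega,
      show i + 1 + l - (i + 1) = l by omega]
    have h1 := (((((hasDerivAt_id x).sub_const x₀).pow (l + 1)).div_const
      ((l + 1).factorial : ℝ)).const_mul (a (i + 1 + l)))
    refine h1.congr_deriv ?_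
    have : (l.factorial : ℝ) ≠ 0 := by positivity
    rw [Nat.factorial_succ]
    push_cast
    simp
    field_simp
    simp
  · simp only [h, if_false]
    by_cases h' : i ≤ k
    · obtain rfl : i = k := by omega
      simpa using hasDerivAt_const x (a i)
    · simpa [h'] using hasDerivAt_const x (0 : ℝ)

lemma taylorSum_self (x₀ : ℝ) {M : ℕ} (a : ℕ → ℝ) {i : ℕ} (hi : i ≤ M) :
    taylorSum x₀ M a i x₀ = a i := by
  unfold taylorSum
  rw [Finset.sum_eq_single i]
  · simp
  · intro k _ hk
    by_cases h : i ≤ k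
    · simp [h, show k - i ≠ 0 by omega]
    · simp [h]
  · intro h
    exact absurd (Finset.mem_range.2 (by omega)) h

lemma continuous_taylorSum (x₀ : ℝ) (M : ℕ) (a : ℕ → ℝ) (i : ℕ) :
    Continuous (taylorSum x₀ M a i) :=
  continuous_iff_continuousAt.2 fun x => (hasDerivAt_taylorSum x₀ M a i x).continuousAt

/-- A two-parameter family of jets with vanishing `t`-derivatives: for fixed `h`, the jets along
the line `t = const` of the Taylor polynomial of `z`, with `σ` times `bump` added to the
component `β`. -/
def curveFamily (z : Jet 2) (M : ℕ) (β : Fin 2) (σ : ℝ) (q : ℝ × ℝ) : Jet 2 :=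
  (q.2, z.2.1, fun α i j => if j = 0 then
    taylorSum z.1 M (fun k => z.2.2 α k 0) i q.2 +
      (if α = β then σ * partialSnd^[i] (bump z.1 M) q else 0) else 0)

lemma continuous_curveFamily (z : Jet 2) (M : ℕ) (β : Fin 2) (σ : ℝ) :
    Continuous (curveFamily z M β σ) := by
  refine continuous_snd.prodMk (continuous_const.prodMk ?_)
  refine continuous_pi fun α => continuous_pi fun i => continuous_pi fun j => ?_
  by_cases hj : j = 0
  · simp only [hj, if_true]
    refine ((continuous_taylorSum _ _ _ _).comp continuous_snd).add ?_
    by_cases hα : α = β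
    · simp only [hα, if_true]
      exact continuous_const.mul (ContDiff.iterate_partialSnd (contDiff_bump _ _) i).continuous
    · simp only [hα, if_false]
      fun_prop
  · simp only [hj, if_false]
    fun_prop

/-- For fixed `h` the coordinates are the successive `x`-derivatives of actual functions of `x`, so
the curve follows `D_x`. This is the input for `HasJetDerivAt.formalSolution`. -/
lemma hasJetDerivAt_curveFamily (c : ℝ → ℝ) (z : Jet 2) (M : ℕ) (β : Fin 2) (σ h x : ℝ) :
    HasJetDerivAt (fun y => extend c 0 (curveFamily z M β σ (h, y)))
      (shiftX (extend c 0 (curveFamily z M β σ (h, x)))) x := by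
  refine ⟨hasDerivAt_id x, hasDerivAt_const x _, fun α i j => ?_⟩
  by_cases hj : j = 0
  · simp only [extend, curveFamily, shiftX, hj, if_true]
    refine (hasDerivAt_taylorSum _ _ _ _ _).add ?_
    by_cases hα : α = β
    · simp only [hα, if_true]
      rw [Function.iterate_succ_apply']
      exact (hasDerivAt_partialSnd
        (ContDiff.iterate_partialSnd (contDiff_bump _ _) i) h x).const_mul σ
    · simpa [hα] using hasDerivAt_const x (0 : ℝ)
  · simpa [extend, hj, shiftX] using hasDerivAt_const x (0 : ℝ)

lemma truncate_curveFamily_left (c : ℝ → ℝ) (z : Jet 2) (M : ℕ) (β : Fin 2) (σ h : ℝ) :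
    truncate M (extend c 0 (curveFamily z M β σ (h, z.1))) = truncate M (extend c 0 z) := by
  refine truncate_eq_iff.2 ⟨rfl, rfl, fun α i j hi _ => ?_⟩
  simp [extend, curveFamily, taylorSum_self _ _ hi, iterate_partialSnd_bump_left _ hi]

/-- The second factor of `bump` makes the perturbation flat at `x = z.1 + h`, so the perturbed and
the unperturbed curve end in the same `M`-jet. For `σ' = 0` the parameter `h'` has no effect. -/
lemma truncate_curveFamily_right (c : ℝ → ℝ) (z : Jet 2) (M : ℕ) (β : Fin 2) (σ σ' h h' : ℝ)
    (hσ : σ' = 0) :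
    truncate M (extend c 0 (curveFamily z M β σ (h, z.1 + h)))
      = truncate M (extend c 0 (curveFamily z M β σ' (h', z.1 + h))) := by
  refine truncate_eq_iff.2 ⟨rfl, rfl, fun α i j hi _ => ?_⟩
  simp [extend, curveFamily, iterate_partialSnd_bump_right _ hi, hσ]

/-! ### Differential functions are no potentials of the dependent variables -/

/-- The determinant `(1 + c² u_x)² - c² v_x²` of the linear system for the derivatives of the
component `f`. -/
def detAt (c : ℝ → ℝ) (z : Jet 2) : ℝ :=
  (1 + c (z.2.2 0 0 0) ^ 2 * z.2.2 0 1 0) ^ 2 - c (z.2.2 0 0 0) ^ 2 * z.2.2 1 1 0 ^ 2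

lemma continuousOn_detAt {I : Set ℝ} {c : ℝ → ℝ} (hc : ContDiffOn ℝ ∞ c I) :
    ContinuousOn (detAt c) {z : Jet 2 | z.2.2 0 0 0 ∈ I} := by
  have h1 : ContinuousOn (fun z : Jet 2 => c (z.2.2 0 0 0)) {z : Jet 2 | z.2.2 0 0 0 ∈ I} :=
    hc.continuousOn.comp (by fun_prop) fun z hz => hz
  have h2 : ContinuousOn (fun z : Jet 2 => z.2.2 0 1 0) {z : Jet 2 | z.2.2 0 0 0 ∈ I} := by
    fun_prop
  have h3 : ContinuousOn (fun z : Jet 2 => z.2.2 1 1 0) {z : Jet 2 | z.2.2 0 0 0 ∈ I} := by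
    fun_prop
  exact ((continuousOn_const.add ((h1.pow 2).mul h2)).pow 2).sub ((h1.pow 2).mul (h3.pow 2))

/-- The jet with `v_x = 1` and all other coordinates zero. -/
def dirVx : Jet 2 := (0, 0, fun α i j => if α = 1 ∧ i = 1 ∧ j = 0 then 1 else 0)

/-- Varying `v_x` alone keeps `C = c(u)` and `u_x` fixed. The determinant is then a difference of
squares whose two factors are linear in `v_x` with slopes `∓C ≠ 0`, so it has at most two zeros. -/
lemma eventually_detAt_ne_zero {c : ℝ → ℝ} {z : Jet 2} (hc : c (z.2.2 0 0 0) ≠ 0) :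
    ∀ᶠ η in 𝓝[≠] (0 : ℝ), detAt c (z + η • dirVx) ≠ 0 := by
  set C := c (z.2.2 0 0 0) with hC
  set a := 1 + C ^ 2 * z.2.2 0 1 0 with ha
  have hfin : ({a / C - z.2.2 1 1 0, -a / C - z.2.2 1 1 0} : Set ℝ).Finite := by simp
  have h : ∀ᶠ η in 𝓝[≠] (0 : ℝ), η ∉ ({a / C - z.2.2 1 1 0, -a / C - z.2.2 1 1 0} : Set ℝ) :=
    nhdsNE_le_cofinite 0 hfin.eventually_cofinite_notMem
  filter_upwards [h] with η hη h0
  apply hη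
  have h1 : (a - C * (z.2.2 1 1 0 + η)) * (a + C * (z.2.2 1 1 0 + η)) = 0 := by
    have : detAt c (z + η • dirVx) = a ^ 2 - C ^ 2 * (z.2.2 1 1 0 + η) ^ 2 := by
      simp [detAt, dirVx, ha, hC]
    rw [this] at h0
    linear_combination h0
  rcases mul_eq_zero.1 h1 with h2 | h2
  · left
    field_simp
    linarith
  · right
    simp only [Set.mem_singleton_iff]
    field_simp
    linarith

/-- Two curves of solution jets that follow `D_x` and share both end jets, up to the order seen by
`F`, give `F` the same increment. The hypothesis forces the increments to differ by `κ` times the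
integral of a function without zeros between the ends. -/
theorem no_potential {I : Set ℝ} {c : ℝ → ℝ} (hI : IsOpen I) (hc : ContDiffOn ℝ ∞ c I)
    (hc0 : ∀ u ∈ I, c u ≠ 0) {n : ℕ} {Ω : Set (FinJet 2 n)} (hΩ : IsOpen Ω) {F : Jet 2 → ℝ}
    (hF : IsDifferentialFunctionOn Ω F) {z₀ : Jet 2} (hz₀ : z₀ ∈ (potentialSystem I c).prolonged)
    (hz₀Ω : truncate n z₀ ∈ Ω) {κ : ℝ} (hκ : κ ≠ 0) (β : Fin 2)
    (h : ∀ z ∈ (potentialSystem I c).prolonged, truncate n z ∈ Ω → detAt c z ≠ 0 →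
      totalX F z = κ * z.2.2 β 0 0) : False := by
  set S : Set (Jet 2) := {z | z.2.2 0 0 0 ∈ I} with hS
  have hSo : IsOpen S := hI.preimage (by fun_prop)
  have hUo : IsOpen (S ∩ (fun z => truncate n (formalSolution c z)) ⁻¹' Ω) :=
    ((continuous_truncate n).comp_continuousOn
      (continuousOn_formalSolution hI hc)).isOpen_inter_preimage hSo hΩ
  have hVo : IsOpen (S ∩ detAt c ⁻¹' {0}ᶜ) :=
    (continuousOn_detAt hc).isOpen_inter_preimage hSo isOpen_compl_singleton
  -- a nearby jet at which the determinant does not vanish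
  obtain ⟨z₁, hz₁U, hz₁V⟩ : ∃ z₁, z₁ ∈ S ∩ (fun z => truncate n (formalSolution c z)) ⁻¹' Ω ∧
      detAt c z₁ ≠ 0 := by
    have hz₀U : z₀ + (0 : ℝ) • dirVx ∈ S ∩ (fun z => truncate n (formalSolution c z)) ⁻¹' Ω := by
      rw [zero_smul, add_zero]
      refine ⟨hz₀.1, ?_⟩
      simpa [formalSolution_eq_self hI hc hz₀] using hz₀Ω
    have hcont : Continuous fun η : ℝ => z₀ + η • dirVx := by fun_prop
    have h1 := nhdsWithin_le_nhds (s := {0}ᶜ)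
      (hcont.continuousAt.preimage_mem_nhds (hUo.mem_nhds hz₀U))
    obtain ⟨η, h2, h3⟩ := (Filter.Eventually.and h1 (eventually_detAt_ne_zero (hc0 _ hz₀.1))).exists
    exact ⟨_, h2, h3⟩
  obtain ⟨M', hM'⟩ := exists_truncate_formalSolution_eq hI hc n
  -- `M ≥ 1` ensures that `M`-jets control `u_x` and `v_x`, on which `detAt` depends.
  set M := M' + 1 with hM
  have hMn : ∀ z z' : Jet 2, z.2.2 0 0 0 ∈ I →
      truncate M (extend c 0 z) = truncate M (extend c 0 z') →
      truncate n (formalSolution c z) = truncate n (formalSolution c z') := by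
    intro z z' hz hzz
    refine hM' z z' hz ?_
    have := truncate_eq_iff.1 hzz
    exact truncate_eq_iff.2 ⟨this.1, this.2.1, fun α i j hi hj =>
      this.2.2 α i j (by omega) (by omega)⟩
  set V := (S ∩ (fun z => truncate n (formalSolution c z)) ⁻¹' Ω) ∩ (S ∩ detAt c ⁻¹' {0}ᶜ) with hV
  have hmem : ∀ σ, curveFamily z₁ M β σ (0, z₁.1) ∈ V := by
    intro σ
    have e := truncate_curveFamily_left c z₁ M β σ 0
    have e' := truncate_eq_iff.1 e
    have e0 : ∀ α i, i ≤ M →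
        (curveFamily z₁ M β σ (0, z₁.1)).2.2 α i 0 = z₁.2.2 α i 0 := fun α i hi => by
      simpa [extend] using e'.2.2 α i 0 hi (by omega)
    have hS' : curveFamily z₁ M β σ (0, z₁.1) ∈ S := by
      simpa [hS, e0 0 0 (by omega)] using hz₁U.1
    refine ⟨⟨hS', ?_⟩, hS', ?_⟩
    · have := hMn _ _ hS' e
      simp only [Set.mem_preimage, this]
      exact hz₁U.2
    · simpa [detAt, e0 0 0 (by omega), e0 0 1 (by omega), e0 1 1 (by omega)] using hz₁V
  -- `V` is open and the family is continuous in `(h, x)` jointly, so for a small interval length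
  -- `h` both curves stay in `V` over the whole interval.
  have hev : ∀ σ, ∀ᶠ q in 𝓝 ((0 : ℝ), z₁.1), curveFamily z₁ M β σ q ∈ V := fun σ =>
    (continuous_curveFamily z₁ M β σ).continuousAt.preimage_mem_nhds
      ((hUo.inter hVo).mem_nhds (hmem σ))
  obtain ⟨δ, hδ, hball⟩ := Metric.eventually_nhds_iff.1 ((hev 0).and (hev 1))
  set η := δ / 2 with hη
  have hη0 : 0 < η := by positivity
  have hin : ∀ x ∈ Set.Icc z₁.1 (z₁.1 + η), curveFamily z₁ M β 0 (η, x) ∈ V ∧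
      curveFamily z₁ M β 1 (η, x) ∈ V := by
    intro x hx
    apply hball
    rw [Prod.dist_eq, max_lt_iff, Real.dist_eq, Real.dist_eq, sub_zero, abs_of_pos hη0,
      abs_of_nonneg (by linarith [hx.1])]
    exact ⟨by linarith, by linarith [hx.2]⟩
  have hder : ∀ σ x, curveFamily z₁ M β σ (η, x) ∈ V →
      HasDerivAt (fun y => F (formalSolution c (curveFamily z₁ M β σ (η, y))))
        (κ * (curveFamily z₁ M β σ (η, x)).2.2 β 0 0) x := by
    intro σ x hx
    have h1 := hF.hasDerivAt_comp hΩ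
      (HasJetDerivAt.formalSolution hI hc (γ := fun y => curveFamily z₁ M β σ (η, y)) hx.1.1
        (hasJetDerivAt_curveFamily c z₁ M β σ η x)) hx.1.2
    have h2 := h _ (formalSolution_mem_prolonged hI hc hx.1.1) hx.1.2
      (by simpa [detAt, formalSolution_coord_zero] using hx.2.2)
    rw [formalSolution_coord_zero] at h2
    rw [← h2]
    exact h1
  have hdiff : ∀ x ∈ Set.Icc z₁.1 (z₁.1 + η),
      HasDerivAt (fun y => F (formalSolution c (curveFamily z₁ M β 1 (η, y)))
        - F (formalSolution c (curveFamily z₁ M β 0 (η, y)))) (κ * bump z₁.1 M (η, x)) x := by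
    intro x hx
    refine ((hder 1 x (hin x hx).2).sub (hder 0 x (hin x hx).1)).congr_deriv ?_
    simp [curveFamily]
    ring
  have hend : ∀ z z' : Jet 2, z ∈ V → z' ∈ V →
      truncate M (extend c 0 z) = truncate M (extend c 0 z') →
      F (formalSolution c z) = F (formalSolution c z') := by
    intro z z' hz hz' hzz
    obtain ⟨G, -, hG⟩ := hF
    rw [hG _ hz.1.2, hG _ hz'.1.2, hMn z z' hz.1.1 hzz]
  have hl := hin z₁.1 ⟨le_rfl, by linarith⟩
  have hr := hin (z₁.1 + η) ⟨by linarith, le_rfl⟩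
  -- Rolle's theorem replaces the integral: the difference of `F` along the two curves vanishes at
  -- both ends, while its derivative `κ * bump` has no zero in between.
  obtain ⟨ξ, hξ, h0⟩ := exists_hasDerivAt_eq_zero (by linarith : z₁.1 < z₁.1 + η)
    (fun x hx => (hdiff x hx).continuousAt.continuousWithinAt)
    (by rw [hend _ _ hl.2 hl.1 (by rw [truncate_curveFamily_left, truncate_curveFamily_left]),
          hend _ _ hr.2 hr.1 (truncate_curveFamily_right c z₁ M β 1 0 η η rfl), sub_self, sub_self])
    (fun x hx => hdiff x (Set.Ioo_subset_Icc_self hx))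
  have h1 : ξ - z₁.1 ≠ 0 := by linarith [hξ.1]
  have h2 : ξ - z₁.1 - η ≠ 0 := by linarith [hξ.2]
  simp [bump, hκ, h1, h2] at h0

/-! ### Point symmetries of the scalar equation -/

lemma lineDeriv_eq_of_eqOn {I : Set ℝ} (hI : IsOpen I) {F G : Jet 1 → ℝ}
    (h : ∀ z : Jet 1, z.2.1 ∈ I → F z = G z) {z v : Jet 1} (hz : z.2.1 ∈ I) {d : ℝ}
    (hG : HasDerivAt (fun s : ℝ => G (z + s • v)) d 0) : lineDeriv ℝ F z v = d := by
  refine (hG.congr_of_eventuallyEq ?_).deriv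
  have := (hasJetDerivAt_line z v).2.1.continuousAt.preimage_mem_nhds
    (hI.mem_nhds (by simpa using hz))
  filter_upwards [this] with s hs using h _ hs

lemma hasDerivAt_coeff {a : ℝ → ℝ} {a' : ℝ} {z : Jet 1} (v : Jet 1) (ha : HasDerivAt a a' z.2.1) :
    HasDerivAt (fun s : ℝ => a (z + s • v).2.1) (a' * v.2.1) 0 :=
  HasDerivAt.comp (0 : ℝ) (by simpa using ha) (hasJetDerivAt_line z v).2.1

/-- The equation involves `c` only through `c²` and `2cc'`. Closed forms `C` and `E` for these,
valid on the open set `I`, avoid differentiating `deriv c`. -/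
lemma lineDeriv_scalarEquation {I : Set ℝ} (hI : IsOpen I) {c C E : ℝ → ℝ} {C' E' : ℝ}
    (hC : ∀ T ∈ I, c T ^ 2 = C T) (hE : ∀ T ∈ I, 2 * c T * deriv c T = E T)
    {z : Jet 1} (hz : z.2.1 ∈ I) (hC' : HasDerivAt C C' z.2.1) (hE' : HasDerivAt E E' z.2.1)
    (v : Jet 1) :
    lineDeriv ℝ ((scalarEquation I c).eq 0) z v =
      v.2.2 0 0 2 + C' * v.2.1 * (C z.2.1 * z.2.2 0 2 0 - z.2.2 0 2 0 * z.2.2 0 0 1 ^ 2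
          - z.2.2 0 0 2 * z.2.2 0 1 0 ^ 2 - 2 * z.2.2 0 1 1
          + 2 * z.2.2 0 1 1 * z.2.2 0 0 1 * z.2.2 0 1 0)
        + C z.2.1 * (C' * v.2.1 * z.2.2 0 2 0 + C z.2.1 * v.2.2 0 2 0
          - v.2.2 0 2 0 * z.2.2 0 0 1 ^ 2 - 2 * z.2.2 0 2 0 * z.2.2 0 0 1 * v.2.2 0 0 1
          - v.2.2 0 0 2 * z.2.2 0 1 0 ^ 2 - 2 * z.2.2 0 0 2 * z.2.2 0 1 0 * v.2.2 0 1 0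
          - 2 * v.2.2 0 1 1 + 2 * v.2.2 0 1 1 * z.2.2 0 0 1 * z.2.2 0 1 0
          + 2 * z.2.2 0 1 1 * v.2.2 0 0 1 * z.2.2 0 1 0
          + 2 * z.2.2 0 1 1 * z.2.2 0 0 1 * v.2.2 0 1 0)
        - E' * v.2.1 * (z.2.2 0 1 0 - z.2.2 0 1 0 ^ 2 * z.2.2 0 0 1)
        - E z.2.1 * (v.2.2 0 1 0 - 2 * z.2.2 0 1 0 * v.2.2 0 1 0 * z.2.2 0 0 1
          - z.2.2 0 1 0 ^ 2 * v.2.2 0 0 1) := by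
  refine lineDeriv_eq_of_eqOn hI (G := fun z => z.2.2 0 0 2 + C z.2.1 * (C z.2.1 * z.2.2 0 2 0
    - z.2.2 0 2 0 * z.2.2 0 0 1 ^ 2 - z.2.2 0 0 2 * z.2.2 0 1 0 ^ 2 - 2 * z.2.2 0 1 1
    + 2 * z.2.2 0 1 1 * z.2.2 0 0 1 * z.2.2 0 1 0)
    - E z.2.1 * (z.2.2 0 1 0 - z.2.2 0 1 0 ^ 2 * z.2.2 0 0 1)) ?_ hz ?_
  · intro z hz
    simp only [scalarEquation, ← hC _ hz, ← hE _ hz]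
  · have h := (hasJetDerivAt_line z v).2.2 0
    have hc := hasDerivAt_coeff v hC'
    have he := hasDerivAt_coeff v hE'
    refine ((((h 0 2).add (hc.mul (((((hc.mul (h 2 0)).sub ((h 2 0).mul ((h 0 1).pow 2))).sub
      ((h 0 2).mul ((h 1 0).pow 2))).sub ((h 1 1).const_mul 2)).add
      ((((h 1 1).const_mul 2).mul (h 0 1)).mul (h 1 0))))).sub
      (he.mul ((h 1 0).sub (((h 1 0).pow 2).mul (h 0 1)))))).congr_deriv ?_
    simp
    ring

/-- The second prolongation of a point field, applied to the scalar equation, from the total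
derivatives of the characteristic. -/
lemma prolong_scalarEquation {I : Set ℝ} (hI : IsOpen I) {c C E : ℝ → ℝ} {C' E' : ℝ}
    (hC : ∀ T ∈ I, c T ^ 2 = C T) (hE : ∀ T ∈ I, 2 * c T * deriv c T = E T)
    {z : Jet 1} (hz : z.2.1 ∈ I) (hC' : HasDerivAt C C' z.2.1) (hE' : HasDerivAt E E' z.2.1)
    (W : PointField) {Q : Jet 1 → ℝ} (hQ : W.toVField.char 0 = Q) {ξ τ Q10 Q01 Q20 Q11 Q02 : ℝ}
    (hξ : W.toVField.ξ z = ξ) (hτ : W.toVField.τ z = τ)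
    (h10 : totalX Q z = Q10) (h01 : totalT Q z = Q01) (h20 : totalX (totalX Q) z = Q20)
    (h11 : totalX (totalT Q) z = Q11) (h02 : totalT (totalT Q) z = Q02) :
    W.toVField.prolong ((scalarEquation I c).eq 0) z =
      (ξ * z.2.2 0 1 2 + τ * z.2.2 0 0 3 + Q02) + C' * τ * (C z.2.1 * z.2.2 0 2 0
          - z.2.2 0 2 0 * z.2.2 0 0 1 ^ 2 - z.2.2 0 0 2 * z.2.2 0 1 0 ^ 2 - 2 * z.2.2 0 1 1
          + 2 * z.2.2 0 1 1 * z.2.2 0 0 1 * z.2.2 0 1 0)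
        + C z.2.1 * (C' * τ * z.2.2 0 2 0
          + (ξ * z.2.2 0 3 0 + τ * z.2.2 0 2 1 + Q20) * (C z.2.1 - z.2.2 0 0 1 ^ 2)
          - (ξ * z.2.2 0 1 2 + τ * z.2.2 0 0 3 + Q02) * z.2.2 0 1 0 ^ 2
          + (ξ * z.2.2 0 2 1 + τ * z.2.2 0 1 2 + Q11)
            * (2 * z.2.2 0 0 1 * z.2.2 0 1 0 - 2)
          + (ξ * z.2.2 0 1 1 + τ * z.2.2 0 0 2 + Q01)
            * (2 * z.2.2 0 1 1 * z.2.2 0 1 0 - 2 * z.2.2 0 2 0 * z.2.2 0 0 1)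
          + (ξ * z.2.2 0 2 0 + τ * z.2.2 0 1 1 + Q10)
            * (2 * z.2.2 0 1 1 * z.2.2 0 0 1 - 2 * z.2.2 0 0 2 * z.2.2 0 1 0))
        - E' * τ * (z.2.2 0 1 0 - z.2.2 0 1 0 ^ 2 * z.2.2 0 0 1)
        - E z.2.1 * ((ξ * z.2.2 0 2 0 + τ * z.2.2 0 1 1 + Q10)
            * (1 - 2 * z.2.2 0 1 0 * z.2.2 0 0 1)
          - z.2.2 0 1 0 ^ 2 * (ξ * z.2.2 0 1 1 + τ * z.2.2 0 0 2 + Q01)) := by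
  unfold VField.prolong totalX totalT
  rw [lineDeriv_scalarEquation hI hC hE hz hC' hE', lineDeriv_scalarEquation hI hC hE hz hC' hE',
    lineDeriv_scalarEquation hI hC hE hz hC' hE', hξ, hτ]
  have e : ∀ α : Fin 1, W.toVField.char α = Q := fun α => by rw [Subsingleton.elim α 0, hQ]
  simp only [e]
  simp only [← h10, ← h01, ← h20, ← h11, ← h02, Function.iterate_succ, Function.iterate_zero,
    Function.comp, id]
  unfold totalX totalT
  ring

/-! ### Powers of `T` and the closed forms of `c²` and `2cc'` for the two coefficients -/

lemma isOpen_ne_zero : IsOpen {u : ℝ | u ≠ 0} := isOpen_ne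

lemma isOpen_pos : IsOpen {u : ℝ | 0 < u} := isOpen_lt continuous_const continuous_id

lemma hasDerivAt_inv_pow (k : ℕ) {T : ℝ} (hT : T ≠ 0) :
    HasDerivAt (fun T : ℝ => (T ^ (k + 1))⁻¹) (-(k + 1) * (T ^ (k + 2))⁻¹) T := by
  refine ((hasDerivAt_pow (k + 1) T).inv (pow_ne_zero _ hT)).congr_deriv ?_
  push_cast
  field_simp
  simp
  ring

lemma hasDerivAt_rpow_of_pos (p q : ℝ) {T : ℝ} (hpq : p - 1 = q) (hT : 0 < T) :
    HasDerivAt (fun T : ℝ => T ^ p) (p * T ^ q) T := by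
  rw [← hpq]
  exact Real.hasDerivAt_rpow_const (Or.inl (ne_of_gt hT))

lemma zpow_coeff_sq : ∀ T ∈ {u : ℝ | u ≠ 0}, ((fun u : ℝ => u ^ (-2 : ℤ)) T) ^ 2 = (T ^ 4)⁻¹ := by
  intro T _
  simp only [zpow_neg]
  norm_cast
  rw [inv_pow, ← pow_mul]

lemma zpow_coeff_deriv : ∀ T ∈ {u : ℝ | u ≠ 0}, 2 * (fun u : ℝ => u ^ (-2 : ℤ)) T
    * deriv (fun u : ℝ => u ^ (-2 : ℤ)) T = -4 * (T ^ 5)⁻¹ := by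
  intro T hT
  have hT : T ≠ 0 := hT
  simp only [deriv_zpow]
  rw [show (-2 - 1 : ℤ) = -3 by norm_num, zpow_neg, zpow_neg]
  norm_cast
  field_simp
  push_cast
  ring

lemma rpow_coeff_sq : ∀ T ∈ {u : ℝ | 0 < u}, ((fun u : ℝ => u ^ (-(2 / 3) : ℝ)) T) ^ 2
    = T ^ (-(4 / 3) : ℝ) := by
  intro T hT
  simp only [← Real.rpow_natCast, ← Real.rpow_mul (le_of_lt hT)]
  norm_num

lemma rpow_coeff_deriv : ∀ T ∈ {u : ℝ | 0 < u}, 2 * (fun u : ℝ => u ^ (-(2 / 3) : ℝ)) T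
    * deriv (fun u : ℝ => u ^ (-(2 / 3) : ℝ)) T = -(4 / 3) * T ^ (-(7 / 3) : ℝ) := by
  intro T hT
  rw [(hasDerivAt_rpow_of_pos (-(2 / 3)) (-(5 / 3)) (by norm_num) hT).deriv]
  have : T ^ (-(7 / 3) : ℝ) = T ^ (-(2 / 3) : ℝ) * T ^ (-(5 / 3) : ℝ) := by
    rw [← Real.rpow_add hT]
    norm_num
  rw [this]
  ring

/-- All exponents for `W₇` are multiples of `1/3`; in terms of `r` the identities become rational
and `field_simp`, `ring` apply. -/
lemma exists_cube_root {T : ℝ} (hT : 0 < T) : ∃ r : ℝ, 0 < r ∧ T = r ^ 3 ∧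
    ∀ (p : ℝ) (k : ℤ), p * 3 = k → T ^ p = r ^ k := by
  have h : T = (T ^ (1 / 3 : ℝ)) ^ 3 := by
    rw [← Real.rpow_natCast, ← Real.rpow_mul hT.le]
    norm_num
  refine ⟨T ^ (1 / 3 : ℝ), Real.rpow_pos_of_pos hT _, h, fun p k hpk => ?_⟩
  rw [← Real.rpow_intCast, ← Real.rpow_mul hT.le, ← hpk]
  ring_nf

lemma isPointSymmetryOf_W₆ :
    W₆.IsPointSymmetryOf (scalarEquation {u : ℝ | u ≠ 0} (fun u => u ^ (-2 : ℤ))) := by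
  intro z hz h0
  have hT : z.2.1 ≠ 0 := hz
  have hQ : W₆.toVField.char 0 = fun z => z.2.2 0 0 0 ^ 2
      + z.2.2 0 0 0 * (z.2.1 ^ 3)⁻¹ * z.2.2 0 1 0 - z.2.1 * z.2.2 0 0 0 * z.2.2 0 0 1 := by
    funext z
    simp [VField.char, PointField.toVField, W₆, div_eq_mul_inv]
  -- The first total derivatives are needed at all jets over `I`, since they are differentiated
  -- again; the second ones only at `z`.
  have h10 : ∀ z : Jet 1, z.2.1 ∈ {u : ℝ | u ≠ 0} → totalX (W₆.toVField.char 0) z =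
      2 * z.2.2 0 0 0 * z.2.2 0 1 0
        + (z.2.1 ^ 3)⁻¹ * (z.2.2 0 1 0 ^ 2 + z.2.2 0 0 0 * z.2.2 0 2 0)
        - z.2.1 * (z.2.2 0 1 0 * z.2.2 0 0 1 + z.2.2 0 0 0 * z.2.2 0 1 1) := by
    intro z hz
    refine lineDeriv_eq_of_eqOn isOpen_ne_zero (v := shiftX z) (fun z _ => congrFun hQ z) hz ?_
    have h := (hasJetDerivAt_line z (shiftX z)).2.2 0
    have hT := (hasJetDerivAt_line z (shiftX z)).2.1
    have ha := hasDerivAt_coeff (shiftX z) (hasDerivAt_inv_pow 2 hz)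
    refine ((((h 0 0).pow 2).add (((h 0 0).mul ha).mul (h 1 0))).sub
      ((hT.mul (h 0 0)).mul (h 0 1))).congr_deriv ?_
    simp [shiftX]
    ring
  have h01 : ∀ z : Jet 1, z.2.1 ∈ {u : ℝ | u ≠ 0} → totalT (W₆.toVField.char 0) z =
      z.2.2 0 0 0 * z.2.2 0 0 1 - 3 * (z.2.1 ^ 4)⁻¹ * (z.2.2 0 0 0 * z.2.2 0 1 0)
        + (z.2.1 ^ 3)⁻¹ * (z.2.2 0 1 0 * z.2.2 0 0 1 + z.2.2 0 0 0 * z.2.2 0 1 1)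
        - z.2.1 * (z.2.2 0 0 1 ^ 2 + z.2.2 0 0 0 * z.2.2 0 0 2) := by
    intro z hz
    refine lineDeriv_eq_of_eqOn isOpen_ne_zero (v := shiftT z) (fun z _ => congrFun hQ z) hz ?_
    have h := (hasJetDerivAt_line z (shiftT z)).2.2 0
    have hT := (hasJetDerivAt_line z (shiftT z)).2.1
    have ha := hasDerivAt_coeff (shiftT z) (hasDerivAt_inv_pow 2 hz)
    refine ((((h 0 0).pow 2).add (((h 0 0).mul ha).mul (h 1 0))).sub
      ((hT.mul (h 0 0)).mul (h 0 1))).congr_deriv ?_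
    simp [shiftT]
    ring
  have h20 : totalX (totalX (W₆.toVField.char 0)) z =
      2 * z.2.2 0 1 0 ^ 2 + 2 * z.2.2 0 0 0 * z.2.2 0 2 0
        + (z.2.1 ^ 3)⁻¹ * (3 * z.2.2 0 1 0 * z.2.2 0 2 0 + z.2.2 0 0 0 * z.2.2 0 3 0)
        - z.2.1 * (z.2.2 0 2 0 * z.2.2 0 0 1 + 2 * z.2.2 0 1 0 * z.2.2 0 1 1
          + z.2.2 0 0 0 * z.2.2 0 2 1) := by
    refine lineDeriv_eq_of_eqOn isOpen_ne_zero (v := shiftX z) h10 hz ?_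
    have h := (hasJetDerivAt_line z (shiftX z)).2.2 0
    have hT := (hasJetDerivAt_line z (shiftX z)).2.1
    have ha := hasDerivAt_coeff (shiftX z) (hasDerivAt_inv_pow 2 hz)
    refine (((((h 0 0).const_mul 2).mul (h 1 0)).add (ha.mul (((h 1 0).pow 2).add
      ((h 0 0).mul (h 2 0))))).sub (hT.mul (((h 1 0).mul (h 0 1)).add
      ((h 0 0).mul (h 1 1))))).congr_deriv ?_
    simp [shiftX]
    ring
  have h11 : totalX (totalT (W₆.toVField.char 0)) z =
      z.2.2 0 1 0 * z.2.2 0 0 1 + z.2.2 0 0 0 * z.2.2 0 1 1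
        - 3 * (z.2.1 ^ 4)⁻¹ * (z.2.2 0 1 0 ^ 2 + z.2.2 0 0 0 * z.2.2 0 2 0)
        + (z.2.1 ^ 3)⁻¹ * (z.2.2 0 2 0 * z.2.2 0 0 1 + 2 * z.2.2 0 1 0 * z.2.2 0 1 1
          + z.2.2 0 0 0 * z.2.2 0 2 1)
        - z.2.1 * (2 * z.2.2 0 0 1 * z.2.2 0 1 1 + z.2.2 0 1 0 * z.2.2 0 0 2
          + z.2.2 0 0 0 * z.2.2 0 1 2) := by
    refine lineDeriv_eq_of_eqOn isOpen_ne_zero (v := shiftX z) h01 hz ?_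
    have h := (hasJetDerivAt_line z (shiftX z)).2.2 0
    have hT := (hasJetDerivAt_line z (shiftX z)).2.1
    have ha := hasDerivAt_coeff (shiftX z) (hasDerivAt_inv_pow 2 hz)
    have hb := hasDerivAt_coeff (shiftX z) (hasDerivAt_inv_pow 3 hz)
    refine (((((h 0 0).mul (h 0 1)).sub ((hb.const_mul 3).mul ((h 0 0).mul (h 1 0)))).add
      (ha.mul (((h 1 0).mul (h 0 1)).add ((h 0 0).mul (h 1 1))))).sub
      (hT.mul (((h 0 1).pow 2).add ((h 0 0).mul (h 0 2))))).congr_deriv ?_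
    simp [shiftX]
    ring
  have h02 : totalT (totalT (W₆.toVField.char 0)) z =
      12 * (z.2.1 ^ 5)⁻¹ * (z.2.2 0 0 0 * z.2.2 0 1 0)
        - 6 * (z.2.1 ^ 4)⁻¹ * (z.2.2 0 1 0 * z.2.2 0 0 1 + z.2.2 0 0 0 * z.2.2 0 1 1)
        + (z.2.1 ^ 3)⁻¹ * (z.2.2 0 1 0 * z.2.2 0 0 2 + 2 * z.2.2 0 0 1 * z.2.2 0 1 1
          + z.2.2 0 0 0 * z.2.2 0 1 2)
        - z.2.1 * (3 * z.2.2 0 0 1 * z.2.2 0 0 2 + z.2.2 0 0 0 * z.2.2 0 0 3) := by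
    refine lineDeriv_eq_of_eqOn isOpen_ne_zero (v := shiftT z) h01 hz ?_
    have h := (hasJetDerivAt_line z (shiftT z)).2.2 0
    have hT := (hasJetDerivAt_line z (shiftT z)).2.1
    have ha := hasDerivAt_coeff (shiftT z) (hasDerivAt_inv_pow 2 hz)
    have hb := hasDerivAt_coeff (shiftT z) (hasDerivAt_inv_pow 3 hz)
    refine (((((h 0 0).mul (h 0 1)).sub ((hb.const_mul 3).mul ((h 0 0).mul (h 1 0)))).add
      (ha.mul (((h 1 0).mul (h 0 1)).add ((h 0 0).mul (h 1 1))))).sub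
      (hT.mul (((h 0 1).pow 2).add ((h 0 0).mul (h 0 2))))).congr_deriv ?_
    simp [shiftT]
    ring
  rw [prolong_scalarEquation isOpen_ne_zero zpow_coeff_sq zpow_coeff_deriv hz (hasDerivAt_inv_pow 3 hz) ((hasDerivAt_inv_pow 4 hz).const_mul (-4))
    W₆ rfl (show _ = -(z.2.2 0 0 0 * (z.2.1 ^ 3)⁻¹) from rfl)
    (show _ = z.2.1 * z.2.2 0 0 0 from rfl) (h10 z hz) (h01 z hz) h20 h11 h02]
  simp only [scalarEquation, zpow_coeff_sq _ hz, zpow_coeff_deriv _ hz] at h0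
  push_cast
  -- The prolongation multiplies the equation by `3 T⁻³ U_X - 3 T U_T`; the third-order terms of the
  -- prolongation cancel identically.
  linear_combination (norm := skip)
    (-3 * z.2.1 * z.2.2 0 0 1 + 3 * (z.2.1 ^ 3)⁻¹ * z.2.2 0 1 0) * h0
  field_simp
  ring

lemma isPointSymmetryOf_W₇ :
    W₇.IsPointSymmetryOf (scalarEquation {u : ℝ | 0 < u} (fun u => u ^ (-(2 / 3) : ℝ))) := by
  intro z hz h0
  have hT : 0 < z.2.1 := hz
  have ha := fun (z v : Jet 1) (hz : z.2.1 ∈ {u : ℝ | 0 < u}) =>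
    hasDerivAt_coeff v (hasDerivAt_rpow_of_pos (-(1 / 3)) (-(4 / 3)) (by norm_num) hz)
  have ha' := fun (z v : Jet 1) (hz : z.2.1 ∈ {u : ℝ | 0 < u}) =>
    hasDerivAt_coeff v (hasDerivAt_rpow_of_pos (-(4 / 3)) (-(7 / 3)) (by norm_num) hz)
  have hb := fun (z v : Jet 1) (hz : z.2.1 ∈ {u : ℝ | 0 < u}) =>
    hasDerivAt_coeff v (hasDerivAt_rpow_of_pos (2 / 3) (-(1 / 3)) (by norm_num) hz)
  have hQ : W₇.toVField.char 0 = fun z =>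
      -(z.1 * z.2.1 ^ (-(1 / 3) : ℝ) - z.1 ^ 2 * (1 / 3)) * z.2.2 0 1 0
        - (z.1 * z.2.1 - 3 * z.2.1 ^ (2 / 3 : ℝ)) * z.2.2 0 0 1 := by
    funext z
    simp [VField.char, PointField.toVField, W₇]
    ring
  have h10 : ∀ z : Jet 1, z.2.1 ∈ {u : ℝ | 0 < u} → totalX (W₇.toVField.char 0) z =
      -(z.2.1 ^ (-(1 / 3) : ℝ) - 2 / 3 * z.1) * z.2.2 0 1 0
        - (z.1 * z.2.1 ^ (-(1 / 3) : ℝ) - z.1 ^ 2 * (1 / 3)) * z.2.2 0 2 0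
        - z.2.1 * z.2.2 0 0 1 - (z.1 * z.2.1 - 3 * z.2.1 ^ (2 / 3 : ℝ)) * z.2.2 0 1 1 := by
    intro z hz
    refine lineDeriv_eq_of_eqOn isOpen_pos (v := shiftX z) (fun z _ => congrFun hQ z) hz ?_
    have h := (hasJetDerivAt_line z (shiftX z)).2.2 0
    have hX := (hasJetDerivAt_line z (shiftX z)).1
    have hT := (hasJetDerivAt_line z (shiftX z)).2.1
    refine (((((hX.mul (ha z (shiftX z) hz)).sub ((hX.pow 2).mul_const (1 / 3))).neg).mul
      (h 1 0)).sub (((hX.mul hT).sub ((hb z (shiftX z) hz).const_mul 3)).mul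
      (h 0 1))).congr_deriv ?_
    simp [shiftX]
    ring
  have h01 : ∀ z : Jet 1, z.2.1 ∈ {u : ℝ | 0 < u} → totalT (W₇.toVField.char 0) z =
      1 / 3 * (z.1 * z.2.1 ^ (-(4 / 3) : ℝ)) * z.2.2 0 1 0
        - (z.1 * z.2.1 ^ (-(1 / 3) : ℝ) - z.1 ^ 2 * (1 / 3)) * z.2.2 0 1 1
        - (z.1 - 2 * z.2.1 ^ (-(1 / 3) : ℝ)) * z.2.2 0 0 1
        - (z.1 * z.2.1 - 3 * z.2.1 ^ (2 / 3 : ℝ)) * z.2.2 0 0 2 := by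
    intro z hz
    refine lineDeriv_eq_of_eqOn isOpen_pos (v := shiftT z) (fun z _ => congrFun hQ z) hz ?_
    have h := (hasJetDerivAt_line z (shiftT z)).2.2 0
    have hX := (hasJetDerivAt_line z (shiftT z)).1
    have hT := (hasJetDerivAt_line z (shiftT z)).2.1
    refine (((((hX.mul (ha z (shiftT z) hz)).sub ((hX.pow 2).mul_const (1 / 3))).neg).mul
      (h 1 0)).sub (((hX.mul hT).sub ((hb z (shiftT z) hz).const_mul 3)).mul
      (h 0 1))).congr_deriv ?_
    simp [shiftT]
    ring
  have h20 : totalX (totalX (W₇.toVField.char 0)) z =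
      2 / 3 * z.2.2 0 1 0 - 2 * (z.2.1 ^ (-(1 / 3) : ℝ) - 2 / 3 * z.1) * z.2.2 0 2 0
        - (z.1 * z.2.1 ^ (-(1 / 3) : ℝ) - z.1 ^ 2 * (1 / 3)) * z.2.2 0 3 0
        - 2 * z.2.1 * z.2.2 0 1 1
        - (z.1 * z.2.1 - 3 * z.2.1 ^ (2 / 3 : ℝ)) * z.2.2 0 2 1 := by
    refine lineDeriv_eq_of_eqOn isOpen_pos (v := shiftX z) h10 hz ?_
    have h := (hasJetDerivAt_line z (shiftX z)).2.2 0
    have hX := (hasJetDerivAt_line z (shiftX z)).1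
    have hT := (hasJetDerivAt_line z (shiftX z)).2.1
    have ha := ha z (shiftX z) hz
    refine ((((((ha.sub (hX.const_mul (2 / 3))).neg).mul (h 1 0)).sub
      (((hX.mul ha).sub ((hX.pow 2).mul_const (1 / 3))).mul (h 2 0))).sub (hT.mul (h 0 1))).sub
      (((hX.mul hT).sub ((hb z (shiftX z) hz).const_mul 3)).mul (h 1 1))).congr_deriv ?_
    simp [shiftX]
    ring
  have h11 : totalX (totalT (W₇.toVField.char 0)) z =
      1 / 3 * z.2.1 ^ (-(4 / 3) : ℝ) * (z.2.2 0 1 0 + z.1 * z.2.2 0 2 0)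
        - (z.2.1 ^ (-(1 / 3) : ℝ) - 2 / 3 * z.1) * z.2.2 0 1 1
        - (z.1 * z.2.1 ^ (-(1 / 3) : ℝ) - z.1 ^ 2 * (1 / 3)) * z.2.2 0 2 1
        - z.2.2 0 0 1 - (z.1 - 2 * z.2.1 ^ (-(1 / 3) : ℝ)) * z.2.2 0 1 1
        - z.2.1 * z.2.2 0 0 2
        - (z.1 * z.2.1 - 3 * z.2.1 ^ (2 / 3 : ℝ)) * z.2.2 0 1 2 := by
    refine lineDeriv_eq_of_eqOn isOpen_pos (v := shiftX z) h01 hz ?_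
    have h := (hasJetDerivAt_line z (shiftX z)).2.2 0
    have hX := (hasJetDerivAt_line z (shiftX z)).1
    have hT := (hasJetDerivAt_line z (shiftX z)).2.1
    have ha := ha z (shiftX z) hz
    refine (((((((hX.mul (ha' z (shiftX z) hz)).const_mul (1 / 3)).mul (h 1 0)).sub
      (((hX.mul ha).sub ((hX.pow 2).mul_const (1 / 3))).mul (h 1 1))).sub
      ((hX.sub (ha.const_mul 2)).mul (h 0 1))).sub
      (((hX.mul hT).sub ((hb z (shiftX z) hz).const_mul 3)).mul (h 0 2)))).congr_deriv ?_
    simp [shiftX]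
    ring
  have h02 : totalT (totalT (W₇.toVField.char 0)) z =
      -(4 / 9) * (z.1 * z.2.1 ^ (-(7 / 3) : ℝ)) * z.2.2 0 1 0
        + 2 / 3 * (z.1 * z.2.1 ^ (-(4 / 3) : ℝ)) * z.2.2 0 1 1
        - (z.1 * z.2.1 ^ (-(1 / 3) : ℝ) - z.1 ^ 2 * (1 / 3)) * z.2.2 0 1 2
        - 2 / 3 * z.2.1 ^ (-(4 / 3) : ℝ) * z.2.2 0 0 1
        - 2 * (z.1 - 2 * z.2.1 ^ (-(1 / 3) : ℝ)) * z.2.2 0 0 2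
        - (z.1 * z.2.1 - 3 * z.2.1 ^ (2 / 3 : ℝ)) * z.2.2 0 0 3 := by
    refine lineDeriv_eq_of_eqOn isOpen_pos (v := shiftT z) h01 hz ?_
    have h := (hasJetDerivAt_line z (shiftT z)).2.2 0
    have hX := (hasJetDerivAt_line z (shiftT z)).1
    have hT := (hasJetDerivAt_line z (shiftT z)).2.1
    have ha := ha z (shiftT z) hz
    refine (((((((hX.mul (ha' z (shiftT z) hz)).const_mul (1 / 3)).mul (h 1 0)).sub
      (((hX.mul ha).sub ((hX.pow 2).mul_const (1 / 3))).mul (h 1 1))).sub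
      ((hX.sub (ha.const_mul 2)).mul (h 0 1))).sub
      (((hX.mul hT).sub ((hb z (shiftT z) hz).const_mul 3)).mul (h 0 2)))).congr_deriv ?_
    simp [shiftT]
    ring
  rw [prolong_scalarEquation isOpen_pos rpow_coeff_sq rpow_coeff_deriv hz (hasDerivAt_rpow_of_pos _ (-(7 / 3)) (by norm_num) hz)
    ((hasDerivAt_rpow_of_pos _ (-(10 / 3)) (by norm_num) hz).const_mul (-(4 / 3)))
    W₇ rfl (show _ = z.1 * z.2.1 ^ (-(1 / 3) : ℝ) - z.1 ^ 2 / 3 from rfl)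
    (show _ = z.1 * z.2.1 - 3 * z.2.1 ^ (2 / 3 : ℝ) from rfl) (h10 z hz) (h01 z hz) h20 h11 h02]
  simp only [scalarEquation, rpow_coeff_sq _ hz, rpow_coeff_deriv _ hz] at h0
  obtain ⟨r, hr, hr', hpow⟩ := exists_cube_root hT
  rw [hpow (-(4 / 3)) (-4) (by norm_num), hpow (-(7 / 3)) (-7) (by norm_num)] at h0
  rw [hpow (-(4 / 3)) (-4) (by norm_num), hpow (-(7 / 3)) (-7) (by norm_num),
    hpow (-(10 / 3)) (-10) (by norm_num), hpow (-(1 / 3)) (-1) (by norm_num),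
    hpow (2 / 3) 2 (by norm_num), hr']
  -- Here the multiplier of the equation is `6 T^(-1/3) - 2X`.
  linear_combination (norm := skip) (6 * r ^ (-1 : ℤ) - 2 * z.1) * h0
  field_simp
  ring

/-! ### Jets of functions on the plane -/

/-- The derivative with respect to the first variable. -/
def partialFst (g : ℝ × ℝ → ℝ) (q : ℝ × ℝ) : ℝ := fderiv ℝ g q (1, 0)

section Plane

variable {D : Set (ℝ × ℝ)} {g : ℝ × ℝ → ℝ}

lemma jetOf_coord {m : ℕ} (w : Fin m → ℝ × ℝ → ℝ) (p : ℝ × ℝ) (α : Fin m) (i j : ℕ) :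
    (jetOf w p).2.2 α i j = (partialFst^[i] (partialSnd^[j] (w α))) p := rfl

lemma contDiffOn_fderiv_apply (hD : IsOpen D) (hg : ContDiffOn ℝ ∞ g D) (e : ℝ × ℝ) :
    ContDiffOn ℝ ∞ (fun q => fderiv ℝ g q e) D :=
  (hg.fderiv_of_isOpen hD (by simp)).clm_apply contDiffOn_const

lemma contDiffOn_iterate_partial (hD : IsOpen D) (hg : ContDiffOn ℝ ∞ g D) (i j : ℕ) :
    ContDiffOn ℝ ∞ (partialFst^[i] (partialSnd^[j] g)) D := by
  have h : ContDiffOn ℝ ∞ (partialSnd^[j] g) D := by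
    induction j with
    | zero => exact hg
    | succ j ih =>
      rw [Function.iterate_succ_apply']
      exact contDiffOn_fderiv_apply hD ih _
  induction i with
  | zero => exact h
  | succ i ih =>
    rw [Function.iterate_succ_apply']
    exact contDiffOn_fderiv_apply hD ih _

lemma contDiffOn_jetOf {m : ℕ} {w : Fin m → ℝ × ℝ → ℝ} (hD : IsOpen D)
    (hw : ∀ α, ContDiffOn ℝ ∞ (w α) D) (α : Fin m) (i j : ℕ) :
    ContDiffOn ℝ ∞ (fun p => (jetOf w p).2.2 α i j) D :=
  contDiffOn_iterate_partial hD (hw α) i j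

lemma hasFDerivAt_of_mem (hD : IsOpen D) (hg : ContDiffOn ℝ ∞ g D) {p : ℝ × ℝ} (hp : p ∈ D) :
    HasFDerivAt g (fderiv ℝ g p) p :=
  ((hg.contDiffAt (hD.mem_nhds hp)).differentiableAt (by simp)).hasFDerivAt

lemma fderiv_fderiv_apply (hD : IsOpen D) (hg : ContDiffOn ℝ ∞ g D) {p : ℝ × ℝ} (hp : p ∈ D)
    (e e' : ℝ × ℝ) :
    fderiv ℝ (fun q => fderiv ℝ g q e) p e' = fderiv ℝ (fderiv ℝ g) p e' e := by
  have h : DifferentiableAt ℝ (fderiv ℝ g) p :=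
    ((hg.fderiv_of_isOpen (m := ∞) hD (by simp)).contDiffAt
      (hD.mem_nhds hp)).differentiableAt (by simp)
  rw [fderiv_clm_apply h (by simp)]
  simp

lemma partialSnd_partialFst (hD : IsOpen D) (hg : ContDiffOn ℝ ∞ g D) {p : ℝ × ℝ} (hp : p ∈ D) :
    partialSnd (partialFst g) p = partialFst (partialSnd g) p := by
  have h1 := fderiv_fderiv_apply hD hg hp (1, 0) (0, 1)
  have h2 := fderiv_fderiv_apply hD hg hp (0, 1) (1, 0)
  have h3 : IsSymmSndFDerivAt ℝ g p :=
    (hg.contDiffAt (hD.mem_nhds hp)).isSymmSndFDerivAt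
      (by
        rw [minSmoothness_of_isRCLikeNormedField]
        exact WithTop.coe_le_coe.2 (le_top : (2 : ℕ∞) ≤ ⊤))
  exact h1.trans ((h3.eq _ _).trans h2.symm)

lemma fderiv_apply_congr (hD : IsOpen D) {g g' : ℝ × ℝ → ℝ} (h : Set.EqOn g g' D) {p : ℝ × ℝ}
    (hp : p ∈ D) (e : ℝ × ℝ) : fderiv ℝ g p e = fderiv ℝ g' p e := by
  rw [(h.eventuallyEq_of_mem (hD.mem_nhds hp)).fderiv_eq]

lemma partialSnd_iterate_partialFst (hD : IsOpen D) (hg : ContDiffOn ℝ ∞ g D) (i : ℕ) :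
    Set.EqOn (partialSnd (partialFst^[i] g)) (partialFst^[i] (partialSnd g)) D := by
  induction i with
  | zero => exact fun _ _ => rfl
  | succ i ih =>
    intro p hp
    rw [Function.iterate_succ_apply', Function.iterate_succ_apply',
      partialSnd_partialFst hD (g := partialFst^[i] g) (contDiffOn_iterate_partial hD hg i 0) hp]
    exact fderiv_apply_congr hD ih hp _

lemma hasDerivAt_line_of_mem (hD : IsOpen D) (hg : ContDiffOn ℝ ∞ g D) {p : ℝ × ℝ} (hp : p ∈ D)
    (e : ℝ × ℝ) : HasDerivAt (fun s : ℝ => g (p + s • e)) (fderiv ℝ g p e) 0 := by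
  have := (hasFDerivAt_of_mem hD hg hp).hasLineDerivAt e
  exact this

lemma hasJetDerivAt_jetOf_fst {m : ℕ} {w : Fin m → ℝ × ℝ → ℝ} (hD : IsOpen D)
    (hw : ∀ α, ContDiffOn ℝ ∞ (w α) D) {p : ℝ × ℝ} (hp : p ∈ D) :
    HasJetDerivAt (fun s : ℝ => jetOf w (p + s • ((1, 0) : ℝ × ℝ))) (shiftX (jetOf w p)) 0 := by
  refine ⟨?_, ?_, fun α i j => ?_⟩
  · simpa [jetOf, shiftX] using (hasDerivAt_id (0 : ℝ)).const_add p.1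
  · simpa [jetOf, shiftX] using hasDerivAt_const (0 : ℝ) p.2
  · refine (hasDerivAt_line_of_mem hD (contDiffOn_jetOf hD hw α i j) hp _).congr_deriv ?_
    simp only [shiftX, jetOf_coord, Function.iterate_succ_apply']
    rfl

lemma hasJetDerivAt_jetOf_snd {m : ℕ} {w : Fin m → ℝ × ℝ → ℝ} (hD : IsOpen D)
    (hw : ∀ α, ContDiffOn ℝ ∞ (w α) D) {p : ℝ × ℝ} (hp : p ∈ D) :
    HasJetDerivAt (fun s : ℝ => jetOf w (p + s • ((0, 1) : ℝ × ℝ))) (shiftT (jetOf w p)) 0 := by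
  refine ⟨?_, ?_, fun α i j => ?_⟩
  · simpa [jetOf, shiftT] using hasDerivAt_const (0 : ℝ) p.1
  · simpa [jetOf, shiftT] using (hasDerivAt_id (0 : ℝ)).const_add p.2
  · refine (hasDerivAt_line_of_mem hD (contDiffOn_jetOf hD hw α i j) hp _).congr_deriv ?_
    simp only [shiftT, jetOf_coord, Function.iterate_succ_apply']
    -- Jet coordinates apply `∂ₜ` first, so a further `∂ₜ` has to be commuted past `∂ₓ^i`.
    exact partialSnd_iterate_partialFst hD (contDiffOn_iterate_partial hD (hw α) 0 j) i hp

/-- The Poincaré lemma for `A dx + B dt`. -/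
lemma exists_potential (hD : IsOpen D) (hDc : Convex ℝ D) {A B : ℝ × ℝ → ℝ}
    (hA : ContDiffOn ℝ ∞ A D) (hB : ContDiffOn ℝ ∞ B D)
    (hAB : ∀ p ∈ D, partialSnd A p = partialFst B p) :
    ∃ f : ℝ × ℝ → ℝ, ContDiffOn ℝ ∞ f D ∧ ∀ p ∈ D, fderiv ℝ f p (1, 0) = A p ∧
      fderiv ℝ f p (0, 1) = B p := by
  set Θ : ℝ × ℝ → ℝ × ℝ →L[ℝ] ℝ := fun p =>
    A p • ContinuousLinearMap.fst ℝ ℝ ℝ + B p • ContinuousLinearMap.snd ℝ ℝ ℝ with hΘ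
  have hΘs : ContDiffOn ℝ ∞ Θ D := (hA.smul contDiffOn_const).add (hB.smul contDiffOn_const)
  have hΘd : ∀ p ∈ D, HasFDerivAt Θ
      ((fderiv ℝ A p).smulRight (ContinuousLinearMap.fst ℝ ℝ ℝ)
        + (fderiv ℝ B p).smulRight (ContinuousLinearMap.snd ℝ ℝ ℝ)) p := by
    intro p hp
    have h1 := (hasFDerivAt_of_mem hD hA hp).smul_const (ContinuousLinearMap.fst ℝ ℝ ℝ)
    have h2 := (hasFDerivAt_of_mem hD hB hp).smul_const (ContinuousLinearMap.snd ℝ ℝ ℝ)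
    exact h1.add h2
  obtain ⟨f, hf⟩ := hDc.exists_forall_hasFDerivAt_of_fderiv_symmetric hD
    (hΘs.differentiableOn (by simp)) (fun p hp x y => by
      have h := hAB p hp
      have hlin : ∀ (L : ℝ × ℝ →L[ℝ] ℝ) (x : ℝ × ℝ), L x = x.1 * L (1, 0) + x.2 * L (0, 1) := by
        intro L x
        conv_lhs => rw [show x = x.1 • ((1, 0) : ℝ × ℝ) + x.2 • ((0, 1) : ℝ × ℝ) by
          ext <;> simp]
        rw [map_add, map_smul, map_smul, smul_eq_mul, smul_eq_mul]
      rw [(hΘd p hp).fderiv]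
      simp only [partialFst, partialSnd] at h
      simp only [add_apply, ContinuousLinearMap.smulRight_apply, smul_apply,
        ContinuousLinearMap.coe_fst', ContinuousLinearMap.coe_snd',
        smul_eq_mul]
      rw [hlin _ x, hlin _ y, hlin (fderiv ℝ B p) x, hlin (fderiv ℝ B p) y, h]
      ring)
  refine ⟨f, ?_, fun p hp => ?_⟩
  · rw [contDiffOn_infty_iff_fderiv_of_isOpen hD]
    refine ⟨fun p hp => (hf p hp).differentiableAt.differentiableWithinAt, ?_⟩
    exact hΘs.congr fun p hp => (hf p hp).fderiv
  · rw [(hf p hp).fderiv]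
    simp [hΘ]

end Plane

/-! ### Solutions and their jets -/

section

variable {I : Set ℝ} {c : ℝ → ℝ}

/-- A differential function that vanishes along the jets of a solution over an open set has
vanishing total derivatives there, by the chain rule along coordinate lines; this is iterated. -/
lemma jetOf_mem_prolonged (hI : IsOpen I) (hc : ContDiffOn ℝ ∞ c I) {D : Set (ℝ × ℝ)}
    (hD : IsOpen D) {w : Fin 2 → ℝ × ℝ → ℝ} (hw : (potentialSystem I c).IsSolutionOn D w)
    {p : ℝ × ℝ} (hp : p ∈ D) : jetOf w p ∈ (potentialSystem I c).prolonged := by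
  refine ⟨(hw.2 p hp).1, fun k i j => ?_⟩
  have hk : IsDifferentialFunctionOver I ((potentialSystem I c).eq k) := by
    obtain ⟨G, hG, hGf⟩ := isDifferentialFunctionOn_flux hc
    fin_cases k
    · exact ⟨1, fun y => y.2.2 1 1 0 - y.2.2 0 0 1, by fun_prop, fun z hz => rfl⟩
    · refine ⟨1, fun y => y.2.2 1 0 1 - G y, ContDiffOn.sub (by fun_prop) hG, fun z hz => ?_⟩
      exact congrArg (fun a => z.2.2 1 0 1 - a) (hGf z hz)
  have hline : ∀ q ∈ D, ∀ e : ℝ × ℝ, ∀ᶠ s in 𝓝 (0 : ℝ), q + s • e ∈ D := by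
    intro q hq e
    have : Continuous fun s : ℝ => q + s • e := by fun_prop
    exact this.continuousAt.preimage_mem_nhds (hD.mem_nhds (by simpa using hq))
  have step : ∀ {F : Jet 2 → ℝ}, IsDifferentialFunctionOver I F →
      (∀ q ∈ D, F (jetOf w q) = 0) →
      ∀ q ∈ D, totalX F (jetOf w q) = 0 ∧ totalT F (jetOf w q) = 0 := by
    intro F hF h0 q hq
    have hu : (jetOf w (q + (0 : ℝ) • ((1, 0) : ℝ × ℝ))).2.2 0 0 0 ∈ I := by
      rw [zero_smul, add_zero]
      exact (hw.2 q hq).1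
    have hu' : (jetOf w (q + (0 : ℝ) • ((0, 1) : ℝ × ℝ))).2.2 0 0 0 ∈ I := by
      rw [zero_smul, add_zero]
      exact (hw.2 q hq).1
    have h1 := hF.hasDerivAt_comp hI (hasJetDerivAt_jetOf_fst hD hw.1 hq) hu
    have h2 := hF.hasDerivAt_comp hI (hasJetDerivAt_jetOf_snd hD hw.1 hq) hu'
    rw [zero_smul, add_zero] at h1 h2
    constructor
    · refine h1.unique ((hasDerivAt_const 0 (0 : ℝ)).congr_of_eventuallyEq ?_)
      filter_upwards [hline q hq (1, 0)] with s hs using h0 _ hs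
    · refine h2.unique ((hasDerivAt_const 0 (0 : ℝ)).congr_of_eventuallyEq ?_)
      filter_upwards [hline q hq (0, 1)] with s hs using h0 _ hs
  have hT : ∀ q ∈ D, (totalT^[j] ((potentialSystem I c).eq k)) (jetOf w q) = 0 := by
    induction j with
    | zero => exact fun q hq => (hw.2 q hq).2 k
    | succ j ih =>
      intro q hq
      rw [Function.iterate_succ_apply']
      exact (step (hk.iterate hI 0 j) ih q hq).2
  have hX : ∀ q ∈ D, (totalX^[i] (totalT^[j] ((potentialSystem I c).eq k))) (jetOf w q) = 0 := by
    induction i with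
    | zero => exact hT
    | succ i ih =>
      intro q hq
      rw [Function.iterate_succ_apply']
      exact (step (hk.iterate hI i j) ih q hq).1
  exact hX p hp

lemma lineDeriv_flux (hI : IsOpen I) (hc : ContDiffOn ℝ ∞ c I) {z : Jet 2}
    (hz : z.2.2 0 0 0 ∈ I) (v : Jet 2) :
    HasDerivAt (fun s : ℝ => flux c (z + s • v)) (2 * c (z.2.2 0 0 0) * deriv c (z.2.2 0 0 0)
      * v.2.2 0 0 0 * z.2.2 0 1 0 + c (z.2.2 0 0 0) ^ 2 * v.2.2 0 1 0) 0 := by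
  have hc' : HasDerivAt c (deriv c (z.2.2 0 0 0)) (z.2.2 0 0 0) :=
    ((hc.contDiffAt (hI.mem_nhds hz)).differentiableAt (by simp)).hasDerivAt
  have h := (hasJetDerivAt_line z v).2.2 0
  have hcomp : HasDerivAt (fun s : ℝ => c ((z + s • v).2.2 0 0 0))
      (deriv c (z.2.2 0 0 0) * v.2.2 0 0 0) 0 :=
    HasDerivAt.comp (0 : ℝ) (by simpa using hc') (h 0 0)
  refine ((hcomp.pow 2).mul (h 1 0)).congr_deriv ?_
  simp only [zero_smul, add_zero, Pi.pow_apply]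
  push_cast
  ring

/-- The differential consequences of order at most two of the potential system. -/
lemma prolonged_relations (hI : IsOpen I) (hc : ContDiffOn ℝ ∞ c I) {z : Jet 2}
    (hz : z ∈ (potentialSystem I c).prolonged) :
    z.2.2 0 0 1 = z.2.2 1 1 0 ∧ z.2.2 1 0 1 = c (z.2.2 0 0 0) ^ 2 * z.2.2 0 1 0 ∧
    z.2.2 0 1 1 = z.2.2 1 2 0 ∧ z.2.2 0 0 2 = z.2.2 1 1 1 ∧
    z.2.2 1 1 1 = 2 * c (z.2.2 0 0 0) * deriv c (z.2.2 0 0 0) * z.2.2 0 1 0 * z.2.2 0 1 0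
      + c (z.2.2 0 0 0) ^ 2 * z.2.2 0 2 0 ∧
    z.2.2 1 0 2 = 2 * c (z.2.2 0 0 0) * deriv c (z.2.2 0 0 0) * z.2.2 0 0 1 * z.2.2 0 1 0
      + c (z.2.2 0 0 0) ^ 2 * z.2.2 0 1 1 := by
  obtain ⟨hu, h⟩ := (mem_prolonged_iff hI hc).1 hz
  refine ⟨(h 0 0).1, (h 0 0).2, (h 1 0).1, (h 0 1).1, ?_, ?_⟩
  · exact (h 1 0).2.trans (lineDeriv_flux hI hc hu (shiftX z)).deriv
  · exact (h 0 1).2.trans (lineDeriv_flux hI hc hu (shiftT z)).deriv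

/-- The linearized potential system. -/
lemma isInfinitesimalDeformation_of_linearized (hI : IsOpen I) (hc : ContDiffOn ℝ ∞ c I)
    {D : Set (ℝ × ℝ)} (hD : IsOpen D) {w δ : Fin 2 → ℝ × ℝ → ℝ}
    (hw : (potentialSystem I c).IsSolutionOn D w) (hδ : ∀ α, ContDiffOn ℝ ∞ (δ α) D)
    (h0 : ∀ p ∈ D, fderiv ℝ (δ 1) p (1, 0) = fderiv ℝ (δ 0) p (0, 1))
    (h1 : ∀ p ∈ D, fderiv ℝ (δ 1) p (0, 1) = c (w 0 p) ^ 2 * fderiv ℝ (δ 0) p (1, 0)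
      + 2 * c (w 0 p) * deriv c (w 0 p) * fderiv ℝ (w 0) p (1, 0) * δ 0 p) :
    (potentialSystem I c).IsInfinitesimalDeformation D w δ := by
  refine ⟨hδ, fun p hp k => ?_⟩
  have hlin : ∀ α e (ε : ℝ), fderiv ℝ (fun q => w α q + ε * δ α q) p e
      = fderiv ℝ (w α) p e + ε * fderiv ℝ (δ α) p e := by
    intro α e ε
    have h : HasFDerivAt (fun q => w α q + ε * δ α q) _ p :=
      (hasFDerivAt_of_mem hD (hw.1 α) hp).add
        ((hasFDerivAt_of_mem hD (hδ α) hp).const_mul ε)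
    rw [h.fderiv]
    simp
  have hd : ∀ a b : ℝ, HasDerivAt (fun ε : ℝ => a + ε * b) b 0 := fun a b => by
    simpa using ((hasDerivAt_id (0 : ℝ)).mul_const b).const_add a
  have e0 : fderiv ℝ (w 1) p (1, 0) - fderiv ℝ (w 0) p (0, 1) = 0 := (hw.2 p hp).2 0
  have hu : w 0 p ∈ I := (hw.2 p hp).1
  fin_cases k
  · have : (fun ε : ℝ => (potentialSystem I c).eq 0 (jetOf (fun α q => w α q + ε * δ α q) p))
        = fun _ => (0 : ℝ) := by
      funext ε
      change fderiv ℝ (fun q => w 1 q + ε * δ 1 q) p (1, 0)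
        - fderiv ℝ (fun q => w 0 q + ε * δ 0 q) p (0, 1) = 0
      rw [hlin, hlin, h0 p hp]
      linear_combination e0
    change HasDerivAt (fun ε : ℝ =>
      (potentialSystem I c).eq 0 (jetOf (fun α q => w α q + ε * δ α q) p)) 0 0
    rw [this]
    exact hasDerivAt_const _ _
  · change HasDerivAt (fun ε : ℝ => fderiv ℝ (fun q => w 1 q + ε * δ 1 q) p (0, 1)
        - c (w 0 p + ε * δ 0 p) ^ 2 * fderiv ℝ (fun q => w 0 q + ε * δ 0 q) p (1, 0)) 0 0
    simp only [hlin]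
    have hc' : HasDerivAt c (deriv c (w 0 p)) (w 0 p) :=
      ((hc.contDiffAt (hI.mem_nhds hu)).differentiableAt (by simp)).hasDerivAt
    have hcomp : HasDerivAt (fun ε : ℝ => c (w 0 p + ε * δ 0 p))
        (deriv c (w 0 p) * δ 0 p) 0 :=
      HasDerivAt.comp (0 : ℝ) (by simpa using hc') (hd _ _)
    refine ((hd _ _).sub ((hcomp.pow 2).mul (hd _ _))).congr_deriv ?_
    rw [h1 p hp]
    simp
    ring

end

/-! ### The symmetry conditions for a traced-back point field -/

section

variable {I : Set ℝ} {c : ℝ → ℝ}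

lemma PointField.char_lift (W : PointField) (f : Jet 2 → ℝ) (α : Fin 2) (z : Jet 2) :
    (W.lift f).char α z = (W.lift fun _ => f z).char α z := by
  fin_cases α <;> rfl

/-- The derivative of the characteristic of `W.lift f` at `z` in the direction `v` is
`K z v (f z) f'`, where `f'` is the derivative of `f`, and the linearized potential system for this
characteristic says that `(f_x - P, f_t - R)` solves the homogeneous linear system with the
determinant `detAt`. -/
structure LinearizedReduction (I : Set ℝ) (c : ℝ → ℝ) (W : PointField)
    (K : Jet 2 → Jet 2 → ℝ → ℝ → Fin 2 → ℝ) (P R : Jet 2 → ℝ) : Prop where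
  hasDerivAt : ∀ {γ : ℝ → Jet 2} {v : Jet 2} {s : ℝ} {f : ℝ → ℝ} {f' : ℝ}, HasJetDerivAt γ v s →
    (γ s).2.2 0 0 0 ∈ I → HasDerivAt f f' s → ∀ α,
    HasDerivAt (fun r => (W.lift fun _ => f r).char α (γ r)) (K (γ s) v (f s) f' α) s
  fst : ∀ z ∈ (potentialSystem I c).prolonged, ∀ f fx ft : ℝ,
    K z (shiftX z) f fx 1 - K z (shiftT z) f ft 0
      = z.2.2 1 1 0 * (ft - R z) - (1 + c (z.2.2 0 0 0) ^ 2 * z.2.2 0 1 0) * (fx - P z)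
  snd : ∀ z ∈ (potentialSystem I c).prolonged, ∀ f fx ft : ℝ,
    K z (shiftT z) f ft 1 - c (z.2.2 0 0 0) ^ 2 * K z (shiftX z) f fx 0
        - 2 * c (z.2.2 0 0 0) * deriv c (z.2.2 0 0 0) * z.2.2 0 1 0
          * (W.lift fun _ => f).char 0 z
      = c (z.2.2 0 0 0) ^ 2 * z.2.2 1 1 0 * (fx - P z)
        - (1 + c (z.2.2 0 0 0) ^ 2 * z.2.2 0 1 0) * (ft - R z)

variable {W : PointField} {K : Jet 2 → Jet 2 → ℝ → ℝ → Fin 2 → ℝ} {P R : Jet 2 → ℝ}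

/-- With `f_x = P` and `f_t = R` the right-hand sides of `fst` and `snd` vanish, whatever the
determinant is, and their left-hand sides are the linearized equations. -/
lemma LinearizedReduction.yieldsSymmetry (hI : IsOpen I) (hc : ContDiffOn ℝ ∞ c I)
    (h : LinearizedReduction I c W K P R)
    (hchar : ∀ (D : Set (ℝ × ℝ)) (w : Fin 2 → ℝ × ℝ → ℝ) (f : ℝ × ℝ → ℝ), IsOpen D →
      (potentialSystem I c).IsSolutionOn D w → ContDiffOn ℝ ∞ f D → ∀ α,
      ContDiffOn ℝ ∞ (fun p => (W.lift fun _ => f p).char α (jetOf w p)) D)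
    (hpot : ∀ (D : Set (ℝ × ℝ)) (w : Fin 2 → ℝ × ℝ → ℝ), IsOpen D → Convex ℝ D →
      (potentialSystem I c).IsSolutionOn D w → ∃ f : ℝ × ℝ → ℝ, ContDiffOn ℝ ∞ f D ∧
        ∀ p ∈ D, fderiv ℝ f p (1, 0) = P (jetOf w p) ∧ fderiv ℝ f p (0, 1) = R (jetOf w p)) :
    YieldsSymmetry I c W := by
  intro D w hD hDc hw
  obtain ⟨f, hf, hfd⟩ := hpot D w hD hDc hw
  refine ⟨f, hf, ?_⟩
  have hδ := hchar D w f hD hw hf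
  have hX : ∀ p ∈ D, ∀ α,
      fderiv ℝ (fun p => (W.lift fun _ => f p).char α (jetOf w p)) p (1, 0)
        = K (jetOf w p) (shiftX (jetOf w p)) (f p) (P (jetOf w p)) α := by
    intro p hp α
    have h1 := h.hasDerivAt (hasJetDerivAt_jetOf_fst hD hw.1 hp)
      (by rw [zero_smul, add_zero]; exact (hw.2 p hp).1)
      (hasDerivAt_line_of_mem hD hf hp (1, 0)) α
    rw [zero_smul, add_zero, (hfd p hp).1] at h1
    exact (hasDerivAt_line_of_mem hD (hδ α) hp (1, 0)).unique h1
  have hT : ∀ p ∈ D, ∀ α,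
      fderiv ℝ (fun p => (W.lift fun _ => f p).char α (jetOf w p)) p (0, 1)
        = K (jetOf w p) (shiftT (jetOf w p)) (f p) (R (jetOf w p)) α := by
    intro p hp α
    have h1 := h.hasDerivAt (hasJetDerivAt_jetOf_snd hD hw.1 hp)
      (by rw [zero_smul, add_zero]; exact (hw.2 p hp).1)
      (hasDerivAt_line_of_mem hD hf hp (0, 1)) α
    rw [zero_smul, add_zero, (hfd p hp).2] at h1
    exact (hasDerivAt_line_of_mem hD (hδ α) hp (0, 1)).unique h1
  refine isInfinitesimalDeformation_of_linearized hI hc hD hw hδ (fun p hp => ?_) fun p hp => ?_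
  · rw [hX p hp, hT p hp]
    linear_combination h.fst _ (jetOf_mem_prolonged hI hc hD hw hp) (f p) (P (jetOf w p))
      (R (jetOf w p))
  · rw [hX p hp, hT p hp]
    have h2 := h.snd _ (jetOf_mem_prolonged hI hc hD hw hp) (f p) (P (jetOf w p))
      (R (jetOf w p))
    rw [sub_self, sub_self, mul_zero, mul_zero, sub_zero] at h2
    change _ - c (w 0 p) ^ 2 * _
      - 2 * c (w 0 p) * deriv c (w 0 p) * fderiv ℝ (w 0) p (1, 0) * _ = 0 at h2
    linear_combination h2

/-- The `∂_t`-component of a local symmetry has a prescribed total derivative `D_x`, wherever the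
determinant does not vanish. -/
lemma LinearizedReduction.totalX_eq (hI : IsOpen I) (hc : ContDiffOn ℝ ∞ c I)
    (h : LinearizedReduction I c W K P R) {n : ℕ} {Ω : Set (FinJet 2 n)} (hΩ : IsOpen Ω)
    {f : Jet 2 → ℝ} (hf : IsDifferentialFunctionOn Ω f)
    (hsymm : (potentialSystem I c).IsLocalSymmetryOn Ω (W.lift f)) {z : Jet 2}
    (hz : z ∈ (potentialSystem I c).prolonged) (hzΩ : truncate n z ∈ Ω) (hdet : detAt c z ≠ 0) :
    totalX f z = P z := by
  have hu : z.2.2 0 0 0 ∈ I := hz.1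
  have hQ : ∀ (v : Jet 2) α, lineDeriv ℝ ((W.lift f).char α) z v
      = K z v (f z) (lineDeriv ℝ f z v) α := by
    intro v α
    have h1 := h.hasDerivAt (hasJetDerivAt_line z v) (by simpa using hu)
      (hf.hasDerivAt_line hΩ v hzΩ) α
    rw [zero_smul, add_zero] at h1
    rw [← h1.deriv]
    exact congrArg (deriv · 0) (funext fun r => W.char_lift f α (z + r • v))
  set q : Jet 2 := (0, 0, fun α i j => (totalX^[i] (totalT^[j] ((W.lift f).char α))) z) with hq
  -- On the solution manifold the terms `ξ D_x` and `τ D_t` of the prolongation vanish, and only the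
  -- evolutionary part remains.
  have hp : ∀ k, lineDeriv ℝ ((potentialSystem I c).eq k) z q = 0 := by
    intro k
    have h1 := hsymm z hz hzΩ k
    have hx : totalX ((potentialSystem I c).eq k) z = 0 := hz.2 k 1 0
    have ht : totalT ((potentialSystem I c).eq k) z = 0 := hz.2 k 0 1
    unfold VField.prolong at h1
    rw [hx, ht] at h1
    simpa using h1
  have hline := hasJetDerivAt_line z q
  have e0 : K z (shiftX z) (f z) (totalX f z) 1 - K z (shiftT z) (f z) (totalT f z) 0 = 0 := by
    rw [← hp 0]
    refine Eq.trans ?_ ((hline.2.2 1 1 0).sub (hline.2.2 0 0 1)).deriv.symm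
    exact congrArg₂ (· - ·) (hQ (shiftX z) 1).symm (hQ (shiftT z) 0).symm
  have e1 : K z (shiftT z) (f z) (totalT f z) 1
      - c (z.2.2 0 0 0) ^ 2 * K z (shiftX z) (f z) (totalX f z) 0
      - 2 * c (z.2.2 0 0 0) * deriv c (z.2.2 0 0 0) * z.2.2 0 1 0
        * (W.lift fun _ => f z).char 0 z = 0 := by
    rw [← hp 1]
    refine Eq.trans ?_ ((hline.2.2 1 0 1).sub (lineDeriv_flux hI hc hu q)).deriv.symm
    have q1 : q.2.2 1 0 1 = K z (shiftT z) (f z) (totalT f z) 1 := hQ (shiftT z) 1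
    have q2 : q.2.2 0 1 0 = K z (shiftX z) (f z) (totalX f z) 0 := hQ (shiftX z) 0
    have q3 : q.2.2 0 0 0 = (W.lift fun _ => f z).char 0 z := rfl
    rw [q1, q2, q3]
    ring
  rw [h.fst z hz] at e0
  rw [h.snd z hz] at e1
  -- Cramer's rule: `f_t - R` is eliminated from the two equations.
  have key : detAt c z * (totalX f z - P z) = 0 := by
    unfold detAt
    linear_combination -(1 + c (z.2.2 0 0 0) ^ 2 * z.2.2 0 1 0) * e0 - z.2.2 1 1 0 * e1
  exact sub_eq_zero.1 ((mul_eq_zero.1 key).resolve_left hdet)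

/-- If the prescribed `D_x f` is the sum of a total derivative and a nonzero multiple of a dependent
variable, then there is no local symmetry. -/
lemma LinearizedReduction.not_yieldsLocalSymmetry (hI : IsOpen I) (hc : ContDiffOn ℝ ∞ c I)
    (hc0 : ∀ u ∈ I, c u ≠ 0) (h : LinearizedReduction I c W K P R) {κ : ℝ} (hκ : κ ≠ 0)
    (β : Fin 2) {G : Jet 2 → ℝ}
    (hG : ∀ n, IsDifferentialFunctionOn (valueIn I n) G)
    (hP : ∀ z ∈ (potentialSystem I c).prolonged, P z = totalX G z + κ * z.2.2 β 0 0) :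
    ¬ YieldsLocalSymmetry I c W := by
  rintro ⟨n, Ω, f, hΩ, ⟨z₀, hz₀, hz₀Ω⟩, hf, hsymm⟩
  have hΩ' : IsOpen (Ω ∩ valueIn I n) := hΩ.inter (isOpen_valueIn hI n)
  -- The order `n` comes from `f`; requiring `hG` at every order lets `G` be read on the same finite
  -- jets.
  have hfG : IsDifferentialFunctionOn (Ω ∩ valueIn I n) (fun z => f z - G z) := by
    obtain ⟨F₁, hF₁, hF₁'⟩ := hf
    obtain ⟨F₂, hF₂, hF₂'⟩ := hG n
    exact ⟨fun y => F₁ y - F₂ y, (hF₁.mono Set.inter_subset_left).sub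
      (hF₂.mono Set.inter_subset_right), fun z hz =>
      congrArg₂ (· - ·) (hF₁' z hz.1) (hF₂' z hz.2)⟩
  refine no_potential hI hc hc0 hΩ' hfG hz₀ ⟨hz₀Ω, hz₀.1⟩ hκ β fun z hz hzΩ hdet => ?_
  have h1 := hf.hasDerivAt_line hΩ (shiftX z) hzΩ.1
  have h2 := (hG n).hasDerivAt_line (isOpen_valueIn hI n) (shiftX z) hzΩ.2
  have h3 : totalX (fun z => f z - G z) z = totalX f z - totalX G z := (h1.sub h2).deriv
  rw [h3, h.totalX_eq hI hc hΩ hf hsymm hz hzΩ.1 hdet, hP z hz]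
  ring

end

/-! ### The coefficient `u⁻²` -/

/-- The derivative of the characteristic of the lift of `W₆`. -/
def charDeriv₆ (z v : Jet 2) (f f' : ℝ) : Fin 2 → ℝ :=
  let u := z.2.2 0 0 0
  let s := z.2.1 + z.2.2 1 0 0
  let s' := v.2.1 + v.2.2 1 0 0
  let d := s' * (u ^ 3)⁻¹ - 3 * s * (u ^ 4)⁻¹ * v.2.2 0 0 0
  ![v.2.2 0 0 0 * s + u * s' + d * z.2.2 0 1 0 + s * (u ^ 3)⁻¹ * v.2.2 0 1 0
      - f' * z.2.2 0 0 1 - f * v.2.2 0 0 1,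
    2 * s * s' - f' + d * z.2.2 1 1 0 + s * (u ^ 3)⁻¹ * v.2.2 1 1 0
      - f' * z.2.2 1 0 1 - f * v.2.2 1 0 1]

lemma contDiffOn_zpow_coeff : ContDiffOn ℝ ∞ (fun u : ℝ => u ^ (-2 : ℤ)) {u : ℝ | u ≠ 0} := by
  have h : ContDiffOn ℝ ∞ (fun u : ℝ => (u ^ 2)⁻¹) {u : ℝ | u ≠ 0} :=
    (contDiff_id.pow 2).contDiffOn.inv fun u hu => pow_ne_zero 2 hu
  refine h.congr fun u _ => ?_
  rw [zpow_neg]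
  norm_cast

lemma char_lift_W₆ (f : ℝ) (z : Jet 2) (α : Fin 2) : (W₆.lift fun _ => f).char α z =
    ![z.2.2 0 0 0 * (z.2.1 + z.2.2 1 0 0)
        + (z.2.1 + z.2.2 1 0 0) * (z.2.2 0 0 0 ^ 3)⁻¹ * z.2.2 0 1 0 - f * z.2.2 0 0 1,
      (z.2.1 + z.2.2 1 0 0) ^ 2 - f
        + (z.2.1 + z.2.2 1 0 0) * (z.2.2 0 0 0 ^ 3)⁻¹ * z.2.2 1 1 0 - f * z.2.2 1 0 1] α := by
  fin_cases α <;> simp [VField.char, PointField.lift, W₆, div_eq_mul_inv]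

/-- The undifferentiated `f` drops out because its coefficients are the `t`-derivatives of the two
equations of (P). `P` and `R` result from solving the remaining linear system for `f_x` and `f_t`.
-/
lemma linearizedReduction_W₆ : LinearizedReduction {u : ℝ | u ≠ 0} (fun u => u ^ (-2 : ℤ)) W₆
    charDeriv₆ (fun z => -z.2.2 0 0 0 - z.2.2 0 1 0 * (z.2.2 0 0 0 ^ 3)⁻¹
      + 3 * (z.2.1 + z.2.2 1 0 0) * z.2.2 1 1 0)
    (fun z => -(z.2.1 + z.2.2 1 0 0) - z.2.2 0 0 1 * (z.2.2 0 0 0 ^ 3)⁻¹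
      + 3 * (z.2.1 + z.2.2 1 0 0) * (1 + z.2.2 1 0 1)) where
  hasDerivAt := by
    intro γ v s f f' hγ hu hf α
    have ha := HasDerivAt.comp (h₂ := fun u : ℝ => (u ^ (2 + 1))⁻¹) s
      (hasDerivAt_inv_pow 2 (T := (γ s).2.2 0 0 0) hu) (hγ.2.2 0 0 0)
    have hs := hγ.2.1.add (hγ.2.2 1 0 0)
    simp only [char_lift_W₆]
    fin_cases α
    · refine ((((hγ.2.2 0 0 0).mul hs).add ((hs.mul ha).mul (hγ.2.2 0 1 0))).sub
        (hf.mul (hγ.2.2 0 0 1))).congr_deriv ?_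
      simp [charDeriv₆]
      ring
    · refine ((((hs.pow 2).sub hf).add ((hs.mul ha).mul (hγ.2.2 1 1 0))).sub
        (hf.mul (hγ.2.2 1 0 1))).congr_deriv ?_
      simp [charDeriv₆]
      ring
  fst := by
    intro z hz f fx ft
    have hu : z.2.2 0 0 0 ≠ 0 := hz.1
    obtain ⟨h1, h2, h3, h4, h5, h6⟩ := prolonged_relations isOpen_ne_zero contDiffOn_zpow_coeff hz
    rw [zpow_coeff_sq _ hu] at *
    simp [charDeriv₆, shiftX, shiftT, h1, h2, h3, h4]
    field_simp
    ring
  snd := by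
    intro z hz f fx ft
    have hu : z.2.2 0 0 0 ≠ 0 := hz.1
    obtain ⟨h1, h2, h3, h4, h5, h6⟩ := prolonged_relations isOpen_ne_zero contDiffOn_zpow_coeff hz
    rw [zpow_coeff_deriv _ hu] at *
    rw [zpow_coeff_sq _ hu] at *
    rw [char_lift_W₆]
    simp only [charDeriv₆, shiftX, shiftT, h1, h2, h3, h4, h5, h6, Matrix.cons_val_zero,
      Matrix.cons_val_one, zero_add]
    field_simp
    ring

/-- The component is `f = u⁻²/2 - g + 3(t+v)²/2`, where `g_x = u` and `g_t = t + v`; such a `g`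
exists because `u_t = v_x`. -/
lemma yieldsSymmetry_W₆ : YieldsSymmetry {u : ℝ | u ≠ 0} (fun u => u ^ (-2 : ℤ)) W₆ := by
  refine linearizedReduction_W₆.yieldsSymmetry isOpen_ne_zero contDiffOn_zpow_coeff ?_ ?_
  · intro D w f hD hw hf α
    have hu : ∀ p ∈ D, (jetOf w p).2.2 0 0 0 ^ 3 ≠ 0 := fun p hp => pow_ne_zero 3 (hw.2 p hp).1
    have hj := contDiffOn_jetOf hD hw.1
    have ht : ContDiffOn ℝ ∞ (fun p : ℝ × ℝ => (jetOf w p).2.1) D := contDiffOn_snd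
    have ha : ContDiffOn ℝ ∞ (fun p => ((jetOf w p).2.2 0 0 0 ^ 3)⁻¹) D :=
      ((hj 0 0 0).pow 3).inv hu
    have hs := ht.add (hj 1 0 0)
    simp only [char_lift_W₆]
    fin_cases α
    · exact (((hj 0 0 0).mul hs).add ((hs.mul ha).mul (hj 0 1 0))).sub (hf.mul (hj 0 0 1))
    · exact (((hs.pow 2).sub hf).add ((hs.mul ha).mul (hj 1 1 0))).sub (hf.mul (hj 1 0 1))
  · intro D w hD hDc hw
    have hj := contDiffOn_jetOf hD hw.1
    have ht : ContDiffOn ℝ ∞ (fun p : ℝ × ℝ => (jetOf w p).2.1) D := contDiffOn_snd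
    have hs : ContDiffOn ℝ ∞ (fun p => (jetOf w p).2.1 + (jetOf w p).2.2 1 0 0) D :=
      ht.add (hj 1 0 0)
    obtain ⟨g, hg, hgd⟩ := exists_potential hD hDc (hj 0 0 0) hs (by
      intro p hp
      have h1 := (prolonged_relations isOpen_ne_zero contDiffOn_zpow_coeff
        (jetOf_mem_prolonged isOpen_ne_zero contDiffOn_zpow_coeff hD hw hp)).1
      have h2 := hasJetDerivAt_jetOf_fst hD hw.1 hp
      have h3 := (hasDerivAt_line_of_mem hD hs hp (1, 0)).unique (h2.2.1.add (h2.2.2 1 0 0))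
      rw [partialFst, h3]
      simpa [shiftX, jetOf_coord] using h1)
    have ha : ContDiffOn ℝ ∞ (fun p => ((jetOf w p).2.2 0 0 0 ^ 2)⁻¹) D :=
      ((hj 0 0 0).pow 2).inv fun p hp => pow_ne_zero 2 (hw.2 p hp).1
    have hf : ContDiffOn ℝ ∞ (fun p => 1 / 2 * ((jetOf w p).2.2 0 0 0 ^ 2)⁻¹ - g p
        + 3 / 2 * ((jetOf w p).2.1 + (jetOf w p).2.2 1 0 0) ^ 2) D :=
      ((contDiffOn_const.mul ha).sub hg).add (contDiffOn_const.mul (hs.pow 2))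
    refine ⟨_, hf, fun p hp => ⟨?_, ?_⟩⟩
    · have h1 := hasJetDerivAt_jetOf_fst hD hw.1 hp
      have h2 := h1.2.2 0 0 0
      have h3 := HasDerivAt.comp (h₂ := fun u : ℝ => (u ^ (1 + 1))⁻¹) (0 : ℝ) (hasDerivAt_inv_pow 1
        (by
        simp only [zero_smul, add_zero]; exact (hw.2 p hp).1)) h2
      have h4 := (hasDerivAt_line_of_mem hD hf hp (1, 0)).unique
        (((h3.const_mul (1 / 2)).sub (hasDerivAt_line_of_mem hD hg hp (1, 0))).add
          (((h1.2.1.add (h1.2.2 1 0 0)).pow 2).const_mul (3 / 2)))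
      rw [h4, (hgd p hp).1]
      simp only [zero_smul, add_zero, Pi.add_apply]
      simp [shiftX]
      ring
    · have h1 := hasJetDerivAt_jetOf_snd hD hw.1 hp
      have h2 := h1.2.2 0 0 0
      have h3 := HasDerivAt.comp (h₂ := fun u : ℝ => (u ^ (1 + 1))⁻¹) (0 : ℝ) (hasDerivAt_inv_pow 1
        (by
        simp only [zero_smul, add_zero]; exact (hw.2 p hp).1)) h2
      have h4 := (hasDerivAt_line_of_mem hD hf hp (0, 1)).unique
        (((h3.const_mul (1 / 2)).sub (hasDerivAt_line_of_mem hD hg hp (0, 1))).add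
          (((h1.2.1.add (h1.2.2 1 0 0)).pow 2).const_mul (3 / 2)))
      rw [h4, (hgd p hp).2]
      simp only [zero_smul, add_zero, Pi.add_apply]
      simp [shiftT]
      ring

/-- Removing `D_x` of the local part `G` of `f` leaves `-u`, the `x`-derivative of the nonlocal part
`-g`. -/
lemma not_yieldsLocalSymmetry_W₆ :
    ¬ YieldsLocalSymmetry {u : ℝ | u ≠ 0} (fun u => u ^ (-2 : ℤ)) W₆ := by
  refine linearizedReduction_W₆.not_yieldsLocalSymmetry isOpen_ne_zero contDiffOn_zpow_coeff
    (fun u hu => zpow_ne_zero _ hu) (κ := -1) (by norm_num) 0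
    (G := fun z => 1 / 2 * (z.2.2 0 0 0 ^ 2)⁻¹ + 3 / 2 * (z.2.1 + z.2.2 1 0 0) ^ 2) (fun n => ?_) fun z hz => ?_
  · refine ⟨fun y => 1 / 2 * (y.2.2 0 0 0 ^ 2)⁻¹ + 3 / 2 * (y.2.1 + y.2.2 1 0 0) ^ 2, ?_,
      fun z _ => rfl⟩
    exact (contDiffOn_const.mul (ContDiffOn.inv (by fun_prop) fun y hy => pow_ne_zero 2 hy)).add
      (by fun_prop)
  · have h := hasJetDerivAt_line z (shiftX z)
    have h1 : totalX (fun z : Jet 2 => 1 / 2 * (z.2.2 0 0 0 ^ 2)⁻¹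
        + 3 / 2 * (z.2.1 + z.2.2 1 0 0) ^ 2) z = _ :=
      (((HasDerivAt.comp (h₂ := fun u : ℝ => (u ^ (1 + 1))⁻¹) (0 : ℝ)
        (hasDerivAt_inv_pow 1 (by simp only [zero_smul, add_zero]; exact hz.1))
        (h.2.2 0 0 0)).const_mul (1 / 2)).add
        (((h.2.1.add (h.2.2 1 0 0)).pow 2).const_mul (3 / 2))).deriv
    rw [h1]
    simp [shiftX]
    ring

/-! ### The coefficient `u^(-2/3)` -/

/-- The derivative of the characteristic of the lift of `W₇`. -/
def charDeriv₇ (z v : Jet 2) (f f' : ℝ) : Fin 2 → ℝ :=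
  let x := z.1
  let u := z.2.2 0 0 0
  let k := x * u ^ (-(1 / 3) : ℝ) - x ^ 2 * (1 / 3)
  let k' := v.1 * u ^ (-(1 / 3) : ℝ) - 1 / 3 * x * u ^ (-(4 / 3) : ℝ) * v.2.2 0 0 0
    - 2 / 3 * x * v.1
  ![v.1 * u + x * v.2.2 0 0 0 - 2 * u ^ (-(1 / 3) : ℝ) * v.2.2 0 0 0
      - k' * z.2.2 0 1 0 - k * v.2.2 0 1 0 - f' * z.2.2 0 0 1 - f * v.2.2 0 0 1,
    -f' - k' * z.2.2 1 1 0 - k * v.2.2 1 1 0 - f' * z.2.2 1 0 1 - f * v.2.2 1 0 1]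

lemma contDiffOn_rpow_pos (p : ℝ) : ContDiffOn ℝ ∞ (fun u : ℝ => u ^ p) {u : ℝ | 0 < u} :=
  contDiffOn_id.rpow_const_of_ne fun _ hu => ne_of_gt hu

lemma char_lift_W₇ (f : ℝ) (z : Jet 2) (α : Fin 2) : (W₇.lift fun _ => f).char α z =
    ![z.1 * z.2.2 0 0 0 - 3 * z.2.2 0 0 0 ^ (2 / 3 : ℝ)
        - (z.1 * z.2.2 0 0 0 ^ (-(1 / 3) : ℝ) - z.1 ^ 2 * (1 / 3)) * z.2.2 0 1 0
        - f * z.2.2 0 0 1,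
      -f - (z.1 * z.2.2 0 0 0 ^ (-(1 / 3) : ℝ) - z.1 ^ 2 * (1 / 3)) * z.2.2 1 1 0
        - f * z.2.2 1 0 1] α := by
  fin_cases α <;> simp [VField.char, PointField.lift, W₇, div_eq_mul_inv]

lemma linearizedReduction_W₇ : LinearizedReduction {u : ℝ | 0 < u}
    (fun u => u ^ (-(2 / 3) : ℝ)) W₇ charDeriv₇ (fun z => -(1 / 3) * (z.1 * z.2.2 1 1 0))
    (fun z => -(1 / 3) * (z.1 * z.2.2 1 0 1) - z.2.2 0 0 0 ^ (-(1 / 3) : ℝ)) where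
  hasDerivAt := by
    intro γ v s f f' hγ hu hf α
    have ha := HasDerivAt.comp (h₂ := fun u : ℝ => u ^ (-(1 / 3) : ℝ)) s
      (hasDerivAt_rpow_of_pos (-(1 / 3)) (-(4 / 3)) (by norm_num) (T := (γ s).2.2 0 0 0) hu)
      (hγ.2.2 0 0 0)
    have hb := HasDerivAt.comp (h₂ := fun u : ℝ => u ^ (2 / 3 : ℝ)) s
      (hasDerivAt_rpow_of_pos (2 / 3) (-(1 / 3)) (by norm_num) (T := (γ s).2.2 0 0 0) hu)
      (hγ.2.2 0 0 0)
    have hk := (hγ.1.mul ha).sub ((hγ.1.pow 2).mul_const (1 / 3))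
    simp only [char_lift_W₇]
    fin_cases α
    · refine ((((hγ.1.mul (hγ.2.2 0 0 0)).sub (hb.const_mul 3)).sub
        (hk.mul (hγ.2.2 0 1 0))).sub (hf.mul (hγ.2.2 0 0 1))).congr_deriv ?_
      simp [charDeriv₇]
      ring
    · refine (((hf.neg).sub (hk.mul (hγ.2.2 1 1 0))).sub (hf.mul (hγ.2.2 1 0 1))).congr_deriv ?_
      simp [charDeriv₇]
      ring
  fst := by
    intro z hz f fx ft
    have hu : 0 < z.2.2 0 0 0 := hz.1
    obtain ⟨h1, h2, h3, h4, h5, h6⟩ := prolonged_relations isOpen_pos (contDiffOn_rpow_pos _) hz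
    rw [rpow_coeff_sq _ hu] at *
    simp only [charDeriv₇, shiftX, shiftT, h1, h2, h3, h4, Matrix.cons_val_zero,
      Matrix.cons_val_one, zero_add]
    ring
  snd := by
    intro z hz f fx ft
    have hu : 0 < z.2.2 0 0 0 := hz.1
    obtain ⟨h1, h2, h3, h4, h5, h6⟩ := prolonged_relations isOpen_pos (contDiffOn_rpow_pos _) hz
    rw [rpow_coeff_deriv _ hu] at *
    rw [rpow_coeff_sq _ hu] at *
    rw [char_lift_W₇]
    simp only [charDeriv₇, shiftX, shiftT, h1, h2, h3, h4, h5, h6, Matrix.cons_val_zero,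
      Matrix.cons_val_one, zero_add]
    obtain ⟨r, hr, hr', hpow⟩ := exists_cube_root hu
    rw [hpow (-(4 / 3)) (-4) (by norm_num), hpow (-(7 / 3)) (-7) (by norm_num),
      hpow (-(1 / 3)) (-1) (by norm_num), hpow (2 / 3) 2 (by norm_num), hr']
    field_simp
    ring

/-- The component is `f = (g - x v)/3`, where `g_x = v` and `g_t = -3u^(-1/3)`. Compatibility is the
second equation of (P), since `u^(-4/3) u_x` is the `x`-derivative of `-3u^(-1/3)`. -/
lemma yieldsSymmetry_W₇ : YieldsSymmetry {u : ℝ | 0 < u} (fun u => u ^ (-(2 / 3) : ℝ)) W₇ := by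
  refine linearizedReduction_W₇.yieldsSymmetry isOpen_pos (contDiffOn_rpow_pos _) ?_ ?_
  · intro D w f hD hw hf α
    have hj := contDiffOn_jetOf hD hw.1
    have hx : ContDiffOn ℝ ∞ (fun p : ℝ × ℝ => (jetOf w p).1) D := contDiffOn_fst
    have hpow : ∀ q : ℝ, ContDiffOn ℝ ∞ (fun p => (jetOf w p).2.2 0 0 0 ^ q) D := fun q =>
      (hj 0 0 0).rpow_const_of_ne fun p hp => ne_of_gt (hw.2 p hp).1
    have hk := (hx.mul (hpow (-(1 / 3)))).sub ((hx.pow 2).mul (contDiffOn_const (c := (1 / 3 : ℝ))))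
    simp only [char_lift_W₇]
    fin_cases α
    · exact (((hx.mul (hj 0 0 0)).sub (contDiffOn_const.mul (hpow (2 / 3)))).sub
        (hk.mul (hj 0 1 0))).sub (hf.mul (hj 0 0 1))
    · exact ((hf.neg).sub (hk.mul (hj 1 1 0))).sub (hf.mul (hj 1 0 1))
  · intro D w hD hDc hw
    have hj := contDiffOn_jetOf hD hw.1
    have hx : ContDiffOn ℝ ∞ (fun p : ℝ × ℝ => (jetOf w p).1) D := contDiffOn_fst
    have ha : ContDiffOn ℝ ∞ (fun p => -3 * (jetOf w p).2.2 0 0 0 ^ (-(1 / 3) : ℝ)) D :=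
      contDiffOn_const.mul ((hj 0 0 0).rpow_const_of_ne fun p hp => ne_of_gt (hw.2 p hp).1)
    obtain ⟨g, hg, hgd⟩ := exists_potential hD hDc (hj 1 0 0) ha (by
      intro p hp
      have hu : 0 < (jetOf w p).2.2 0 0 0 := (hw.2 p hp).1
      have h1 := (prolonged_relations isOpen_pos (contDiffOn_rpow_pos _)
        (jetOf_mem_prolonged isOpen_pos (contDiffOn_rpow_pos _) hD hw hp)).2.1
      rw [rpow_coeff_sq _ hu] at h1
      have h2 := HasDerivAt.comp (h₂ := fun u : ℝ => u ^ (-(1 / 3) : ℝ)) (0 : ℝ)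
        (hasDerivAt_rpow_of_pos (-(1 / 3)) (-(4 / 3)) (by norm_num)
          (by simp only [zero_smul, add_zero]; exact hu))
        ((hasJetDerivAt_jetOf_fst hD hw.1 hp).2.2 0 0 0)
      have h3 := (hasDerivAt_line_of_mem hD ha hp (1, 0)).unique (h2.const_mul (-3))
      rw [partialFst, h3]
      simp only [zero_smul, add_zero, shiftX, zero_add]
      refine Eq.trans h1 ?_
      ring)
    have hf : ContDiffOn ℝ ∞ (fun p => 1 / 3 * (g p - (jetOf w p).1 * (jetOf w p).2.2 1 0 0)) D :=
      contDiffOn_const.mul (hg.sub (hx.mul (hj 1 0 0)))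
    refine ⟨_, hf, fun p hp => ⟨?_, ?_⟩⟩
    · have h1 := hasJetDerivAt_jetOf_fst hD hw.1 hp
      have h4 := (hasDerivAt_line_of_mem hD hf hp (1, 0)).unique
        (((hasDerivAt_line_of_mem hD hg hp (1, 0)).sub
          (h1.1.mul (h1.2.2 1 0 0))).const_mul (1 / 3))
      rw [h4, (hgd p hp).1]
      simp only [zero_smul, add_zero, shiftX]
      ring
    · have h1 := hasJetDerivAt_jetOf_snd hD hw.1 hp
      have h4 := (hasDerivAt_line_of_mem hD hf hp (0, 1)).unique
        (((hasDerivAt_line_of_mem hD hg hp (0, 1)).sub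
          (h1.1.mul (h1.2.2 1 0 0))).const_mul (1 / 3))
      rw [h4, (hgd p hp).2]
      simp only [zero_smul, add_zero, shiftT]
      ring

/-- Since `-x v_x/3 = D_x(-x v/3) + v/3`, a local `f` would provide a local potential of `v`. -/
lemma not_yieldsLocalSymmetry_W₇ :
    ¬ YieldsLocalSymmetry {u : ℝ | 0 < u} (fun u => u ^ (-(2 / 3) : ℝ)) W₇ := by
  refine linearizedReduction_W₇.not_yieldsLocalSymmetry isOpen_pos (contDiffOn_rpow_pos _)
    (fun u hu => (Real.rpow_pos_of_pos hu _).ne') (κ := 1 / 3) (by norm_num) 1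
    (G := fun z => -(1 / 3) * (z.1 * z.2.2 1 0 0)) (fun n => ?_) fun z hz => ?_
  · refine ⟨fun y => -(1 / 3) * (y.1 * y.2.2 1 0 0), ?_, fun z _ => rfl⟩
    fun_prop
  · have h := hasJetDerivAt_line z (shiftX z)
    have h1 : totalX (fun z : Jet 2 => -(1 / 3) * (z.1 * z.2.2 1 0 0)) z = _ :=
      ((h.1.mul (h.2.2 1 0 0)).const_mul (-(1 / 3))).deriv
    rw [h1]
    simp only [zero_smul, add_zero, shiftX]
    ring

end NonlocalSymm

end

theorem proposition2 :
    NonlocalSymm.YieldsNonlocalSymmetry {u : ℝ | u ≠ 0} (fun u => u ^ (-2 : ℤ))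
        NonlocalSymm.W₆ ∧
      NonlocalSymm.YieldsNonlocalSymmetry {u : ℝ | 0 < u} (fun u => u ^ (-(2 / 3) : ℝ))
        NonlocalSymm.W₇ :=
  ⟨⟨NonlocalSymm.isPointSymmetryOf_W₆, NonlocalSymm.yieldsSymmetry_W₆,
      NonlocalSymm.not_yieldsLocalSymmetry_W₆⟩,
    NonlocalSymm.isPointSymmetryOf_W₇, NonlocalSymm.yieldsSymmetry_W₇,
      NonlocalSymm.not_yieldsLocalSymmetry_W₇⟩
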